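/- **Setting.** Fix $p$ and let $(y_i,d_i,\mathbf z_i)$, $i=1,2,\dots$, be i.i.d. copies of $(Y,D,Z)\in\mathbb R\times\mathbb R\times\mathbb R^p$ with finite second moments and $y_i=\beta d_i+\mathbf z_i^{T}\alpha+\epsilon_i$, where $E(\epsilon_i\mid \mathbf z_i)=0$ and $E(\epsilon_i^2\mid \mathbf z_i)=\sigma_\epsilon^2>0$ (the exposure $d_i$ may be correlated with $\epsilon_i$). Let $\omega^*=\{j:\alpha_j\neq0\}$ be the set of invalid instruments. Assume $|\omega^*|<p/2$, that $E(ZZ^T)$ is nonsingular, and that every valid instrument is relevant: the $j$-th entry of $E(ZZ^T)^{-1}E(ZD)$ is nonzero for all $j\notin\omega^*$. For the data $\mathcal D=(\mathbf y,\mathbf d,\mathbf Z)$ of the first $n$ observations write $\mathbf P_{\mathbf A}=\mathbf A(\mathbf A^T\mathbf A)^{-1}\mathbf A^T$, and for $\omega\in\Omega=\{\omega\subseteq\{1,\dots,p\}:|\omega|<p/2\}$ let $\mathbf R_\omega=(\mathbf d,\mathbf Z_\omega)$, $\hat{\mathbf y}_\omega=\mathbf R_\omega(\mathbf R_\omega^T\mathbf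 P_{\mathbf Z}\mathbf R_\omega)^{-1}\mathbf R_\omega^T\mathbf P_{\mathbf Z}\mathbf y$, $\hat\sigma_\omega^2=n^{-1}\|\mathbf y-\hat{\mathbf y}_\omega\|_2^2$. The pseudo-likelihood of $\theta_\omega=(\beta,\alpha_\omega)\in\mathbb R^{1+|\omega|}$ is $$\tilde f(\mathbf y\mid\theta_\omega,\omega)=\frac{1}{(2\pi\hat\sigma_\omega^2)^{p/2}\,|n^{-1}\mathbf Z^T\mathbf Z|^{1/2}}\exp\Big\{-\frac{1}{2\hat\sigma_\omega^2}\|\mathbf P_{\mathbf Z}(\mathbf y-\mathbf R_\omega\theta_\omega)\|_2^2\Big\}.$$ With the flat prior on $\theta_\omega$ and the prior $\pi(\omega)\propto1(|\omega|<p/2)$, let $\tilde f(\mathbf y\mid\omega)=\int\tilde f(\mathbf y\mid\theta_\omega,\omega)\,d\theta_\omega$, let $\pi(\omega\mid\mathcal D)=\tilde f(\mathbf y\mid\omega)/\sum_{\omega'\in\Omega}\tilde f(\mathbf y\mid\omega')$ for $\omega\in\Omega$, and let $\pi(\beta\mid\omega,\mathcal D)$ be the $\beta$-marginal of the posterior density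 $\tilde f(\mathbf y\mid\theta_\omega,\omega)/\tilde f(\mathbf y\mid\omega)$ of $\theta_\omega$. For $A\subseteq\Omega$ let $\pi_A(\beta\mid\mathcal D)=\sum_{\omega\in A}\pi(\beta\mid\omega,\mathcal D)\,\pi(\omega\mid\mathcal D)/\sum_{\omega'\in A}\pi(\omega'\mid\mathcal D)$, and for $c\ge1$ let $\mathcal A_c=\{\omega\in\Omega:\max_{\omega'\in\Omega}\pi(\omega'\mid\mathcal D)\le c\,\pi(\omega\mid\mathcal D)\}$. With $\hat{\mathbf d}=\mathbf P_{\mathbf Z}\mathbf d$ and $\mathbf M=\mathbf I-\mathbf P_{\mathbf Z_{\omega^*}}$, the oracle two-stage least squares estimator is $\hat\beta_{\rm oracle}=(\hat{\mathbf d}^T\mathbf M\hat{\mathbf d})^{-1}\hat{\mathbf d}^T\mathbf M\mathbf y$; put $$\sigma^2_{\rm oracle}=\sigma_\epsilon^2\{E(Z^TD)E(ZZ^T)^{-1}E(ZD)-E(Z_{\omega^*}^TD)E(Z_{\omega^*}Z_{\omega^*}^T)^{-1}E(Z_{\omega^*}D)\}^{-1}.$$ **Theorem 2.** As $n\to\infty$: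 1. $\pi(\omega^*\mid\mathcal D)\to1$ in probability. 2. (Overfitted models.) If $\omega\in\Omega$ and $\omega\supsetneq\omega^*$, then $\{2\log\tilde f(\mathbf y\mid\omega)-2\log\tilde f(\mathbf y\mid\omega^*)\}/\log n\to|\omega^*|-|\omega|$ in probability. 3. (Misspecified models.) If $\omega\in\Omega$ and $\omega\not\supseteq\omega^*$, then, with $T_{n,\omega}=\|\mathbf P_{\mathbf Z}(\mathbf y-\hat{\mathbf y}_\omega)\|_2^2/\hat\sigma_\omega^2$, $$\frac{2\log\tilde f(\mathbf y\mid\omega)-2\log\tilde f(\mathbf y\mid\omega^*)+T_{n,\omega}}{\log n}\to|\omega^*|-|\omega|\quad\text{in probability},$$ and $T_{n,\omega}/n\to\kappa_\omega$ in probability for some constant $\kappa_\omega>0$. 4. (Oracle limit of the posterior of $\beta$.) $\sigma^2_{\rm oracle}>0$ and $\sqrt n(\hat\beta_{\rm oracle}-\beta)\to\mathcal N(0,\sigma^2_{\rm oracle})$ in distribution. For $A=\mathcal A_c$ with any fixed $c\ge1$, and also for $A=\Omega$, the total variation distance between $\pi_A(\beta\mid\mathcal D)$ and $\pi(\beta\mid\omega^*,\mathcal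 D)$ tends to $0$ in probability, and so does the total variation distance between the law of $\sqrt n(b-\hat\beta_{\rm oracle})$ under $b\sim\pi_A(\cdot\mid\mathcal D)$ and $\mathcal N(0,\sigma^2_{\rm oracle})$. -/

import Mathlib

open MeasureTheory ProbabilityTheory Filter Topology
open scoped Matrix

noncomputable section

/-- A data set `(y, d, Z)` with `n` observations and `p` candidate instruments. -/
structure IVData (n p : ℕ) where
  /-- the outcomes -/
  y : Fin n → ℝ
  /-- the exposures -/
  d : Fin n → ℝ
  /-- the matrix of instruments, one row per observation -/
  Z : Matrix (Fin n) (Fin p) ℝ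

/-- The orthogonal projection matrix `A (Aᵀ A)⁻¹ Aᵀ` onto the column space of `A`. -/
def projMat {n : ℕ} {κ : Type*} [Fintype κ] [DecidableEq κ] (A : Matrix (Fin n) κ ℝ) :
    Matrix (Fin n) (Fin n) ℝ :=
  A * (Aᵀ * A)⁻¹ * Aᵀ

/-- The model space: candidate sets of invalid instruments with fewer than `p / 2` elements. -/
def modelSpace (p : ℕ) : Finset (Finset (Fin p)) :=
  Finset.univ.filter fun ω => (ω.card : ℝ) < (p : ℝ) / 2

namespace IVData

variable {n p : ℕ} (D : IVData n p)

/-- `Z_ω`: the columns of `Z` with index in `ω`. -/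
def Zsub (ω : Finset (Fin p)) : Matrix (Fin n) ω ℝ := fun i j => D.Z i j

/-- `R_ω = (d, Z_ω)`; the column `none` is the exposure. -/
def R (ω : Finset (Fin p)) : Matrix (Fin n) (Option ω) ℝ :=
  fun i k => k.elim (D.d i) (fun j => D.Z i j)

/-- The two-stage least squares estimator
`(R_ωᵀ P_Z R_ω)⁻¹ R_ωᵀ P_Z y` of `θ_ω = (β, α_ω)`; the coordinate `none` is `β`. -/
def thetaHat (ω : Finset (Fin p)) : Option ω → ℝ :=
  (((D.R ω)ᵀ * projMat D.Z * D.R ω)⁻¹ * ((D.R ω)ᵀ * projMat D.Z)) *ᵥ D.y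

/-- The fitted values `ŷ_ω = R_ω (R_ωᵀ P_Z R_ω)⁻¹ R_ωᵀ P_Z y`. -/
def yHat (ω : Finset (Fin p)) : Fin n → ℝ := D.R ω *ᵥ D.thetaHat ω

/-- The variance estimator `n⁻¹ ‖y - ŷ_ω‖²` of the model `ω`. -/
def sigmaHatSq (ω : Finset (Fin p)) : ℝ := (n : ℝ)⁻¹ * ∑ i, (D.y i - D.yHat ω i) ^ 2

/-- `‖P_Z v‖²` (Euclidean norm). -/
def projNormSq (v : Fin n → ℝ) : ℝ := ∑ i, ((projMat D.Z *ᵥ v) i) ^ 2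

/-- The pseudo-likelihood of `θ_ω` in the model `ω`. -/
def pseudoLik (ω : Finset (Fin p)) (θ : Option ω → ℝ) : ℝ :=
  1 / ((2 * Real.pi * D.sigmaHatSq ω) ^ ((p : ℝ) / 2) *
      Real.sqrt (((n : ℝ)⁻¹ • (D.Zᵀ * D.Z)).det)) *
    Real.exp (-(1 / (2 * D.sigmaHatSq ω)) * D.projNormSq (D.y - D.R ω *ᵥ θ))

/-- The marginal pseudo-likelihood of the model `ω`, under the flat prior on `θ_ω`. -/
def margLik (ω : Finset (Fin p)) : ℝ := ∫ θ : Option ω → ℝ, D.pseudoLik ω θ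

/-- The posterior probability `π(ω ∣ D)` under the prior `π(ω) ∝ 1(|ω| < p / 2)`. -/
def postModel (ω : Finset (Fin p)) : ℝ :=
  (if ω ∈ modelSpace p then D.margLik ω else 0) / ∑ ω' ∈ modelSpace p, D.margLik ω'

/-- The posterior distribution of `θ_ω` given the model `ω` (flat prior). -/
def postTheta (ω : Finset (Fin p)) : Measure (Option ω → ℝ) :=
  volume.withDensity fun θ => ENNReal.ofReal (D.pseudoLik ω θ / D.margLik ω)

/-- The posterior distribution of `β` given the model `ω`. -/
def postBeta (ω : Finset (Fin p)) : Measure ℝ := (D.postTheta ω).map fun θ => θ none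

/-- The posterior distribution of `β` averaged over the models in `A`, with the posterior model
probabilities renormalised to `A`. -/
def avgPostBeta (A : Finset (Finset (Fin p))) : Measure ℝ :=
  ∑ ω ∈ A, ENNReal.ofReal (D.postModel ω / ∑ ω' ∈ A, D.postModel ω') • D.postBeta ω

open Classical in
/-- The models `ω` with `max_{ω'} π(ω' ∣ D) / π(ω ∣ D) ≤ c`. -/
def bestModels (c : ℝ) : Finset (Finset (Fin p)) :=
  (modelSpace p).filter fun ω => ∀ ω' ∈ modelSpace p, D.postModel ω' ≤ c * D.postModel ω

/-- `d̂_Z = P_Z d`. -/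
def dHat : Fin n → ℝ := projMat D.Z *ᵥ D.d

/-- The two-stage least squares estimator of `β` that takes `ω` as the set of invalid
instruments: `(d̂_Zᵀ M_{Z_ω} d̂_Z)⁻¹ d̂_Zᵀ M_{Z_ω} y` with `M_{Z_ω} = I - P_{Z_ω}`. -/
def tsls (ω : Finset (Fin p)) : ℝ :=
  (D.dHat ⬝ᵥ ((1 - projMat (D.Zsub ω)) *ᵥ D.dHat))⁻¹ *
    (D.dHat ⬝ᵥ ((1 - projMat (D.Zsub ω)) *ᵥ D.y))

/-- The quadratic term `‖P_Z (y - ŷ_ω)‖² / σ̂²_ω` of `-2 log` marginal pseudo-likelihood. -/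
def misfit (ω : Finset (Fin p)) : ℝ := D.projNormSq (D.y - D.yHat ω) / D.sigmaHatSq ω

end IVData

/-- Total variation distance of two finite measures. -/
def tvDistance {E : Type*} [MeasurableSpace E] (P Q : Measure E) : ℝ :=
  ⨆ B : {B : Set E // MeasurableSet B}, |P.real B.1 - Q.real B.1|

/-- The index set of the invalid instruments: the support of the direct effects `α`. -/
def invalidSet {p : ℕ} (α : Fin p → ℝ) : Finset (Fin p) :=
  open Classical in Finset.univ.filter fun j => α j ≠ 0

section Population

variable {Ω : Type*} [MeasurableSpace Ω] {p : ℕ}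

/-- The structural error `y_i - β d_i - z_iᵀ α` of the outcome model. -/
def structErr (y d : ℕ → Ω → ℝ) (z : ℕ → Ω → Fin p → ℝ) (β : ℝ) (α : Fin p → ℝ)
    (i : ℕ) (w : Ω) : ℝ :=
  y i w - β * d i w - z i w ⬝ᵥ α

/-- `E(Z Zᵀ)`. -/
def popZZ (μ : Measure Ω) (z : ℕ → Ω → Fin p → ℝ) : Matrix (Fin p) (Fin p) ℝ :=
  fun j k => ∫ w, z 0 w j * z 0 w k ∂μ

/-- `E(Z D)`. -/
def popZD (μ : Measure Ω) (d : ℕ → Ω → ℝ) (z : ℕ → Ω → Fin p → ℝ) : Fin p → ℝ :=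
  fun j => ∫ w, z 0 w j * d 0 w ∂μ

/-- The outcome model `y_i = β d_i + z_iᵀ α + ε_i` for an i.i.d. sample `(y_i, d_i, z_i)`, with
`E(ε_i ∣ z_i) = 0` and `E(ε_i² ∣ z_i) = σ²`, and the moment and rank conditions of the
generalized method of moments: finite second moments, `E(Z Zᵀ)` nonsingular, and a nonzero
coefficient of every instrument `j` with `α_j = 0` in the linear projection of `D` on `Z`.
The exposure may be correlated with the error. -/
structure IVModel (μ : Measure Ω) (y d : ℕ → Ω → ℝ) (z : ℕ → Ω → Fin p → ℝ)
    (β : ℝ) (α : Fin p → ℝ) (σsq : ℝ) : Prop where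
  measurable_y : ∀ i, Measurable (y i)
  measurable_d : ∀ i, Measurable (d i)
  measurable_z : ∀ i, Measurable (z i)
  indep : iIndepFun (fun i w => (y i w, d i w, z i w)) μ
  ident : ∀ i, IdentDistrib (fun w => (y i w, d i w, z i w)) (fun w => (y 0 w, d 0 w, z 0 w)) μ μ
  memLp_y : MemLp (y 0) 2 μ
  memLp_d : MemLp (d 0) 2 μ
  memLp_z : ∀ j, MemLp (fun w => z 0 w j) 2 μ
  sigma_pos : 0 < σsq
  err_mean : ∀ i, μ[structErr y d z β α i | MeasurableSpace.comap (z i) inferInstance]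
    =ᵐ[μ] fun _ => 0
  err_var : ∀ i, μ[fun w => structErr y d z β α i w ^ 2 |
    MeasurableSpace.comap (z i) inferInstance] =ᵐ[μ] fun _ => σsq
  nonsing : (popZZ μ z).det ≠ 0
  relevant : ∀ j, α j = 0 → ((popZZ μ z)⁻¹ *ᵥ popZD μ d z) j ≠ 0

/-- The asymptotic variance
`σ² {E(Zᵀ D) E(Z Zᵀ)⁻¹ E(Z D) - E(Z_ωᵀ D) E(Z_ω Z_ωᵀ)⁻¹ E(Z_ω D)}⁻¹` of the oracle estimator. -/
def oracleVar (μ : Measure Ω) (d : ℕ → Ω → ℝ) (z : ℕ → Ω → Fin p → ℝ) (σsq : ℝ)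
    (ω : Finset (Fin p)) : ℝ :=
  σsq * (popZD μ d z ⬝ᵥ ((popZZ μ z)⁻¹ *ᵥ popZD μ d z) -
    (fun j : ω => popZD μ d z j) ⬝ᵥ
      (((popZZ μ z).submatrix (fun j : ω => (j : Fin p)) (fun j : ω => (j : Fin p)))⁻¹ *ᵥ
        fun j : ω => popZD μ d z j))⁻¹

/-- The first `n` observations. -/
def ivSample (y d : ℕ → Ω → ℝ) (z : ℕ → Ω → Fin p → ℝ) (n : ℕ) (w : Ω) : IVData n p where
  y := fun i => y i w
  d := fun i => d i w
  Z := fun i j => z i w j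

end Population

end

/-! The marginal pseudo-likelihood is a Gaussian integral and hence explicit. Completing the square
at the two-stage least squares estimator (`projNormSq_sub`) turns 2 log f(ω) into -T_ω - (1 + |ω|)
log n plus a remainder continuous in the sample moments and σ̂²_ω
(`two_mul_log_margLik_add_misfit`), where T_ω is the misfit. The remainder converges by the law of
large numbers, so after division by log n only the dimension penalty and T_ω matter.

Identification comes from the majority condition. Two sets with fewer than p/2 elements cannot cover
the instruments, so every candidate ω leaves out a valid, hence relevant, instrument. This makes the
population Gram matrix positive definite and makes the population residual moments vanish exactly
when ω contains ω* (`popResid_eq_zero_iff`). If ω misses an invalid instrument, T_ω / n has a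
positive limit. If ω contains ω*, the sample residual moments are n^{-1/2} times a linear image of
the score, which is bounded in L², and T_ω = o_p(log n). Hence f(ω) / f(ω*) tends to 0 for every ω ≠
ω*, and there are finitely many models, so the posterior concentrates on ω*.

For β, the posterior in ω* is exactly Gaussian, centred at the oracle estimator
(`tsls_eq_thetaHat_none`), and n times its variance tends to the oracle variance. A mixture differs
from one component in total variation by at most one minus the weight of that component, which
transfers the limit to the averaged posteriors. Normality of the oracle estimator follows from its
exact expansion in the score, the central limit theorem and Slutsky's lemma.

Convergence in probability is handled as convergence along one filter, `probFilter`, on pairs (n,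
w). Continuous mapping is then composition of limits, and nondegeneracy of the sample is an eventual
property. -/

noncomputable section

/-! ### Schur complements and Gram matrices of moments. -/

namespace Matrix

/-- The Schur complement identity for a symmetric matrix with a distinguished index `none`:
it expresses the `none` entry of the solution of `H x = q`. -/
lemma schur_none_mulVec_inv {κ : Type*} [Fintype κ] [DecidableEq κ]
    (H : Matrix (Option κ) (Option κ) ℝ) (hH : IsUnit H.det) (hsymm : Hᵀ = H)
    (hC : IsUnit (H.submatrix some some).det) (q : Option κ → ℝ) :
    q none - (fun j => H none (some j)) ⬝ᵥ ((H.submatrix some some)⁻¹ *ᵥ fun j => q (some j)) =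
      (H none none - (fun j => H none (some j)) ⬝ᵥ
        ((H.submatrix some some)⁻¹ *ᵥ fun j => H none (some j))) * (H⁻¹ *ᵥ q) none := by
  set C := H.submatrix some some with hCdef
  set h : κ → ℝ := fun j => H none (some j)
  set a := C⁻¹ *ᵥ h with ha
  have hCs : Cᵀ = C := by rw [hCdef, transpose_submatrix, hsymm]
  have hCa : C *ᵥ a = h := by
    rw [ha, mulVec_mulVec, mul_nonsing_inv _ hC, one_mulVec]
  -- Block elimination: `x` is chosen so that `H *ᵥ x` is supported at `none`. Pairing `x` with `q =
  -- H *ᵥ (H⁻¹ *ᵥ q)` then isolates the `none` coordinate of the solution.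
  set x : Option κ → ℝ := fun k => k.elim 1 (fun j => - a j) with hx
  have hHx : H *ᵥ x = Pi.single none (H none none - h ⬝ᵥ a) := by
    ext k
    rcases k with _ | j
    · simp [mulVec, dotProduct, hx, Fintype.sum_option, h, sub_eq_add_neg]
    · have h1 : H (some j) none = h j := congrFun (congrFun hsymm (some j)) none |>.symm
      have h2 := congrFun hCa j
      simp only [mulVec, dotProduct, hCdef, submatrix_apply] at h2
      simp [mulVec, dotProduct, hx, Fintype.sum_option, h1, h2]
  have hsol : H *ᵥ (H⁻¹ *ᵥ q) = q := by
    rw [mulVec_mulVec, mul_nonsing_inv _ hH, one_mulVec]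
  have e1 : x ⬝ᵥ q = (H none none - h ⬝ᵥ a) * (H⁻¹ *ᵥ q) none := by
    conv_lhs => rw [← hsol]
    rw [dotProduct_mulVec, ← mulVec_transpose, hsymm, hHx, single_dotProduct]
  have e2 : h ⬝ᵥ (C⁻¹ *ᵥ fun j => q (some j)) = a ⬝ᵥ fun j => q (some j) := by
    rw [dotProduct_mulVec, ← mulVec_transpose, transpose_nonsing_inv, hCs]
  rw [← e1, e2]
  simp [dotProduct, hx, Fintype.sum_option, sub_eq_add_neg]

end Matrix

/-- The cross moments of the instruments with `R_ω = (d, Z_ω)`, from the second moment matrix `S` of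
the instruments and their cross moments `s` with the exposure. -/
def crossMat {p : ℕ} (S : Matrix (Fin p) (Fin p) ℝ) (s : Fin p → ℝ) (ω : Finset (Fin p)) :
    Matrix (Fin p) (Option ω) ℝ :=
  Matrix.of fun i k => k.elim (s i) (fun j => S i j)

/-- The matrix `Qᵀ S⁻¹ Q` with `Q` the cross moments of the instruments with `R_ω`. -/
def gramMat {p : ℕ} (S : Matrix (Fin p) (Fin p) ℝ) (s : Fin p → ℝ) (ω : Finset (Fin p)) :
    Matrix (Option ω) (Option ω) ℝ :=
  (crossMat S s ω)ᵀ * S⁻¹ * crossMat S s ω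

/-- The vector of direct effects that a parameter of the model `ω` stands for: its extension by
zero off `ω`. -/
def extendZero {p : ℕ} (ω : Finset (Fin p)) (θ : Option ω → ℝ) : Fin p → ℝ :=
  fun j => if h : j ∈ ω then θ (some ⟨j, h⟩) else 0

/-- Replaces a parameter whose type depends on `ω` by a pair in ℝ × ℝ^p, in which different models
and the true parameter can be compared. It serves both the data matrix `R` and the moment matrix
`crossMat`. -/
lemma optionElim_mulVec {p : ℕ} {ι : Type*} (a : ι → ℝ) (M : Matrix ι (Fin p) ℝ)
    (ω : Finset (Fin p)) (θ : Option ω → ℝ) :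
    (Matrix.of fun i (k : Option ω) => k.elim (a i) fun j => M i j) *ᵥ θ =
      θ none • a + M *ᵥ extendZero ω θ := by
  ext i
  have e1 : ∑ k : ω, M i k * θ (some k) = ∑ k : ω, M i k * extendZero ω θ k :=
    Finset.sum_congr rfl fun k _ => by simp [extendZero]
  have e2 : ∑ k : ω, M i k * extendZero ω θ k = ∑ j, M i j * extendZero ω θ j := by
    rw [Finset.sum_coe_sort ω fun j => M i j * extendZero ω θ j]
    exact Finset.sum_subset (Finset.subset_univ _) fun j _ hj => by simp [extendZero, hj]
  simp only [Matrix.mulVec, dotProduct, Fintype.sum_option, Matrix.of_apply,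
    Option.elim_none, Option.elim_some, Pi.add_apply, Pi.smul_apply, smul_eq_mul]
  rw [e1, e2, mul_comm]

section Moments

variable {p : ℕ} {S : Matrix (Fin p) (Fin p) ℝ} {s : Fin p → ℝ} {ω : Finset (Fin p)}

/-- The columns of `crossMat` indexed by `ω` are columns of `S`, and `S⁻¹` cancels them.
Consequently `gramMat` has the simple blocks sᵀS⁻¹s, s_ω and S_ωω. -/
lemma crossMat_transpose_mul_inv_mulVec (hS : IsUnit S.det) (hsymm : Sᵀ = S) (v : Fin p → ℝ) :
    ((crossMat S s ω)ᵀ * S⁻¹) *ᵥ v = fun k => k.elim (s ⬝ᵥ (S⁻¹ *ᵥ v)) (fun j => v j) := by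
  rw [← Matrix.mulVec_mulVec]
  ext k
  rcases k with _ | j
  · rfl
  · have h : S *ᵥ (S⁻¹ *ᵥ v) = v := by
      rw [Matrix.mulVec_mulVec, Matrix.mul_nonsing_inv _ hS, Matrix.one_mulVec]
    have h2 : ((crossMat S s ω)ᵀ *ᵥ (S⁻¹ *ᵥ v)) (some j) = (Sᵀ *ᵥ (S⁻¹ *ᵥ v)) j := rfl
    rw [h2, hsymm, h, Option.elim_some]

lemma gramMat_apply (hS : IsUnit S.det) (hsymm : Sᵀ = S) (k l : Option ω) :
    gramMat S s ω k l =
      k.elim (s ⬝ᵥ (S⁻¹ *ᵥ fun i => crossMat S s ω i l)) (fun j => crossMat S s ω j l) := by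
  exact congrFun (crossMat_transpose_mul_inv_mulVec (s := s) (ω := ω) hS hsymm
    fun i => crossMat S s ω i l) k

lemma gramMat_transpose (hsymm : Sᵀ = S) : (gramMat S s ω)ᵀ = gramMat S s ω := by
  simp [gramMat, Matrix.transpose_mul, Matrix.transpose_nonsing_inv, hsymm, Matrix.mul_assoc]

lemma gramMat_none_none (hS : IsUnit S.det) (hsymm : Sᵀ = S) :
    gramMat S s ω none none = s ⬝ᵥ (S⁻¹ *ᵥ s) := by
  rw [gramMat_apply hS hsymm]; rfl

lemma gramMat_none_some (hS : IsUnit S.det) (hsymm : Sᵀ = S) (j : ω) :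
    gramMat S s ω none (some j) = s j := by
  rw [← gramMat_transpose hsymm, Matrix.transpose_apply, gramMat_apply hS hsymm]; rfl

lemma gramMat_submatrix_some (hS : IsUnit S.det) (hsymm : Sᵀ = S) :
    (gramMat S s ω).submatrix some some =
      S.submatrix (fun j : ω => (j : Fin p)) (fun j : ω => (j : Fin p)) := by
  ext j k
  rw [Matrix.submatrix_apply, gramMat_apply hS hsymm]; rfl

/-- It suffices that `crossMat` is injective. Applying `S⁻¹` to a kernel relation and reading it at
a relevant instrument outside `ω` kills the exposure coefficient, after which the other coefficients
vanish too. -/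
lemma gramMat_posDef (hS : S.PosDef) (hrel : ∃ j ∉ ω, (S⁻¹ *ᵥ s) j ≠ 0) :
    (gramMat S s ω).PosDef := by
  have hu : IsUnit S.det := (Matrix.isUnit_iff_isUnit_det _).1 hS.isUnit
  have := hS.inv.conjTranspose_mul_mul_same (B := crossMat S s ω) ?_
  · simpa [gramMat, Matrix.conjTranspose_eq_transpose_of_trivial] using this
  · refine (injective_iff_map_eq_zero (Matrix.mulVecLin (crossMat S s ω))).2 fun x hx => ?_
    rw [Matrix.mulVecLin_apply] at hx
    have h1 : crossMat S s ω *ᵥ x = x none • s + S *ᵥ extendZero ω x :=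
      optionElim_mulVec _ _ _ _
    have h2 : x none • (S⁻¹ *ᵥ s) + extendZero ω x = 0 := by
      have := congrArg (fun v => S⁻¹ *ᵥ v) (h1.symm.trans hx)
      simpa [Matrix.mulVec_add, Matrix.mulVec_smul, Matrix.mulVec_mulVec,
        Matrix.nonsing_inv_mul _ hu] using this
    obtain ⟨j, hj, hj0⟩ := hrel
    have h3 : x none = 0 := by
      have := congrFun h2 j
      simpa [extendZero, hj, hj0] using this
    rw [h3, zero_smul, zero_add] at h2
    ext k
    rcases k with _ | k
    · exact h3
    · have := congrFun h2 k
      simpa [extendZero] using this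

/-- The Schur complement of the `ω` block in `gramMat S s ω`. -/
def schurCompl (S : Matrix (Fin p) (Fin p) ℝ) (s : Fin p → ℝ) (ω : Finset (Fin p))
    (v : Fin p → ℝ) : ℝ :=
  s ⬝ᵥ (S⁻¹ *ᵥ v) - (fun j : ω => s j) ⬝ᵥ
    ((S.submatrix (fun j : ω => (j : Fin p)) (fun j : ω => (j : Fin p)))⁻¹ *ᵥ fun j : ω => v j)

/-- The algebraic core of Frisch–Waugh–Lovell: partialling out `ω` equals solving the full normal
equations and keeping the exposure coordinate, up to a factor independent of `v`. -/
lemma schurCompl_eq_mul (hS : S.PosDef) (hG : IsUnit (gramMat S s ω).det) (v : Fin p → ℝ) :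
    schurCompl S s ω v = schurCompl S s ω s *
      ((gramMat S s ω)⁻¹ *ᵥ (((crossMat S s ω)ᵀ * S⁻¹) *ᵥ v)) none := by
  have hu : IsUnit S.det := (Matrix.isUnit_iff_isUnit_det _).1 hS.isUnit
  have hsymm : Sᵀ = S := hS.1
  have hC : IsUnit ((gramMat S s ω).submatrix some some).det := by
    rw [gramMat_submatrix_some hu hsymm]
    exact (Matrix.isUnit_iff_isUnit_det _).1 (hS.submatrix Subtype.val_injective).isUnit
  have := Matrix.schur_none_mulVec_inv _ hG (gramMat_transpose hsymm) hC
    (((crossMat S s ω)ᵀ * S⁻¹) *ᵥ v)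
  rw [gramMat_submatrix_some hu hsymm, gramMat_none_none hu hsymm] at this
  simp only [gramMat_none_some hu hsymm] at this
  rw [schurCompl, schurCompl, ← this, crossMat_transpose_mul_inv_mulVec hu hsymm]
  rfl

/-- The case of the unit vector at `none` as right-hand side. It identifies the bracket in the
oracle variance with the inverse of a diagonal entry of the inverse Gram matrix, and shows that the
Schur complement is nonzero. -/
lemma schurCompl_mul_inv (hS : S.PosDef) (hG : IsUnit (gramMat S s ω).det) :
    schurCompl S s ω s * (gramMat S s ω)⁻¹ none none = 1 := by
  have hu : IsUnit S.det := (Matrix.isUnit_iff_isUnit_det _).1 hS.isUnit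
  have hsymm : Sᵀ = S := hS.1
  have hC : IsUnit ((gramMat S s ω).submatrix some some).det := by
    rw [gramMat_submatrix_some hu hsymm]
    exact (Matrix.isUnit_iff_isUnit_det _).1 (hS.submatrix Subtype.val_injective).isUnit
  have := Matrix.schur_none_mulVec_inv _ hG (gramMat_transpose hsymm) hC (Pi.single none 1)
  rw [gramMat_submatrix_some hu hsymm, gramMat_none_none hu hsymm] at this
  simp only [gramMat_none_some hu hsymm] at this
  have hz : (fun j : ω => (Pi.single none 1 : Option ω → ℝ) (some j)) = 0 := by ext; simp
  rw [hz] at this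
  simpa [schurCompl] using this.symm

end Moments

/-! ### Two-stage least squares in terms of sample moments. -/

namespace IVData

variable {n p : ℕ} (D : IVData n p)

/-- The sample moment vector `n⁻¹ Zᵀ v`. -/
def mom (v : Fin n → ℝ) : Fin p → ℝ := (n : ℝ)⁻¹ • (D.Zᵀ *ᵥ v)

/-- The sample moment matrix `n⁻¹ Zᵀ Z`. -/
def momZZ : Matrix (Fin p) (Fin p) ℝ := (n : ℝ)⁻¹ • (D.Zᵀ * D.Z)

/-- The sample moment matrix `n⁻¹ Zᵀ R_ω`. -/
def momZR (ω : Finset (Fin p)) : Matrix (Fin p) (Option ω) ℝ := (n : ℝ)⁻¹ • (D.Zᵀ * D.R ω)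

lemma momZR_eq (ω : Finset (Fin p)) : D.momZR ω = crossMat D.momZZ (D.mom D.d) ω := by
  ext i k
  rcases k with _ | j <;>
  simp [momZR, momZZ, mom, crossMat, Matrix.mul_apply, Matrix.mulVec, dotProduct, R]

/-- The normalised Gram matrix `n⁻¹ R_ωᵀ P_Z R_ω`, in terms of sample moments. -/
def gram (ω : Finset (Fin p)) : Matrix (Option ω) (Option ω) ℝ :=
  (D.momZR ω)ᵀ * D.momZZ⁻¹ * D.momZR ω

lemma gram_eq (ω : Finset (Fin p)) : D.gram ω = gramMat D.momZZ (D.mom D.d) ω := by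
  rw [gram, momZR_eq, gramMat]

lemma momZZ_posSemidef : D.momZZ.PosSemidef := by
  have h := (Matrix.posSemidef_conjTranspose_mul_self D.Z).smul
    (show (0 : ℝ) ≤ (n : ℝ)⁻¹ by positivity)
  simpa [momZZ, Matrix.conjTranspose_eq_transpose_of_trivial] using h

lemma momZZ_posDef (hS : IsUnit D.momZZ.det) : D.momZZ.PosDef :=
  D.momZZ_posSemidef.posDef_iff_det_ne_zero.2 hS.ne_zero

lemma momZZ_transpose : D.momZZᵀ = D.momZZ := by simp [momZZ]

lemma gram_posSemidef (ω : Finset (Fin p)) : (D.gram ω).PosSemidef := by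
  have := D.momZZ_posSemidef.inv.conjTranspose_mul_mul_same (D.momZR ω)
  simpa [gram, Matrix.conjTranspose_eq_transpose_of_trivial] using this

lemma gram_posDef {ω : Finset (Fin p)} (hG : IsUnit (D.gram ω).det) : (D.gram ω).PosDef :=
  (D.gram_posSemidef ω).posDef_iff_det_ne_zero.2 hG.ne_zero

lemma projMat_transpose : (projMat D.Z)ᵀ = projMat D.Z := by
  simp [projMat, Matrix.transpose_mul, Matrix.transpose_nonsing_inv, Matrix.mul_assoc]

lemma transpose_mulVec_eq (hn : n ≠ 0) (v : Fin n → ℝ) : D.Zᵀ *ᵥ v = (n : ℝ) • D.mom v := by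
  rw [mom, smul_smul, mul_inv_cancel₀ (Nat.cast_ne_zero.2 hn), one_smul]

lemma inv_transpose_mul_self (hn : n ≠ 0) (hS : IsUnit D.momZZ.det) :
    (D.Zᵀ * D.Z)⁻¹ = (n : ℝ)⁻¹ • D.momZZ⁻¹ := by
  have hn' : (n : ℝ) ≠ 0 := Nat.cast_ne_zero.2 hn
  have h : D.Zᵀ * D.Z = (n : ℝ) • D.momZZ := by
    rw [momZZ, smul_smul, mul_inv_cancel₀ hn', one_smul]
  refine Matrix.inv_eq_left_inv ?_
  rw [h, Matrix.smul_mul, Matrix.mul_smul, smul_smul, inv_mul_cancel₀ hn', one_smul,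
    Matrix.nonsing_inv_mul _ hS]

/-- The bilinear form of `P_Z` in terms of sample moments. -/
lemma dotProduct_projMat_mulVec (hn : n ≠ 0) (hS : IsUnit D.momZZ.det) (v w : Fin n → ℝ) :
    v ⬝ᵥ (projMat D.Z *ᵥ w) = n * (D.mom v ⬝ᵥ (D.momZZ⁻¹ *ᵥ D.mom w)) := by
  have hn' : (n : ℝ) ≠ 0 := Nat.cast_ne_zero.2 hn
  rw [projMat, ← Matrix.mulVec_mulVec, ← Matrix.mulVec_mulVec, Matrix.dotProduct_mulVec v,
    ← Matrix.mulVec_transpose, D.inv_transpose_mul_self hn hS, D.transpose_mulVec_eq hn,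
    D.transpose_mulVec_eq hn, Matrix.mulVec_smul, Matrix.smul_mulVec, smul_smul,
    mul_inv_cancel₀ hn', one_smul, smul_dotProduct, smul_eq_mul]

lemma projMat_mul_Z (hn : n ≠ 0) (hS : IsUnit D.momZZ.det) : projMat D.Z * D.Z = D.Z := by
  have hn' : (n : ℝ) ≠ 0 := Nat.cast_ne_zero.2 hn
  have h : D.Zᵀ * D.Z = (n : ℝ) • D.momZZ := by
    rw [momZZ, smul_smul, mul_inv_cancel₀ hn', one_smul]
  rw [projMat, Matrix.mul_assoc, D.inv_transpose_mul_self hn hS, h, Matrix.mul_assoc,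
    Matrix.smul_mul, Matrix.mul_smul, Matrix.mul_smul, Matrix.mul_smul, smul_smul, inv_mul_cancel₀ hn', one_smul,
    Matrix.nonsing_inv_mul _ hS, Matrix.mul_one]

lemma projMat_mul_self (hn : n ≠ 0) (hS : IsUnit D.momZZ.det) :
    projMat D.Z * projMat D.Z = projMat D.Z := by
  conv_lhs => rw [projMat.eq_1 D.Z]
  rw [← Matrix.mul_assoc, ← projMat]
  rw [← Matrix.mul_assoc, D.projMat_mul_Z hn hS, ← projMat]

lemma projNormSq_eq (hn : n ≠ 0) (hS : IsUnit D.momZZ.det) (v : Fin n → ℝ) :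
    D.projNormSq v = n * (D.mom v ⬝ᵥ (D.momZZ⁻¹ *ᵥ D.mom v)) := by
  rw [← D.dotProduct_projMat_mulVec hn hS, projNormSq]
  have : ∑ i, ((projMat D.Z *ᵥ v) i) ^ 2 = (projMat D.Z *ᵥ v) ⬝ᵥ (projMat D.Z *ᵥ v) := by
    simp [dotProduct, sq]
  rw [this, Matrix.dotProduct_mulVec, ← Matrix.mulVec_transpose, projMat_transpose,
    Matrix.mulVec_mulVec, D.projMat_mul_self hn hS, dotProduct_comm]

lemma R_mulVec (ω : Finset (Fin p)) (θ : Option ω → ℝ) :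
    D.R ω *ᵥ θ = θ none • D.d + D.Z *ᵥ extendZero ω θ :=
  optionElim_mulVec _ _ _ _

lemma mom_R_mulVec (ω : Finset (Fin p)) (θ : Option ω → ℝ) :
    D.mom (D.R ω *ᵥ θ) = D.momZR ω *ᵥ θ := by
  rw [mom, momZR, Matrix.mulVec_mulVec, Matrix.smul_mulVec]

lemma mom_sub (v w : Fin n → ℝ) : D.mom (v - w) = D.mom v - D.mom w := by
  rw [mom, mom, mom, Matrix.mulVec_sub, smul_sub]

lemma R_transpose_mul_projMat (hn : n ≠ 0) (hS : IsUnit D.momZZ.det) (ω : Finset (Fin p))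
    (v : Fin n → ℝ) :
    ((D.R ω)ᵀ * projMat D.Z) *ᵥ v =
      (n : ℝ) • (((D.momZR ω)ᵀ * D.momZZ⁻¹) *ᵥ D.mom v) := by
  ext k
  have h1 : (((D.R ω)ᵀ * projMat D.Z) *ᵥ v) k = (fun i => D.R ω i k) ⬝ᵥ (projMat D.Z *ᵥ v) := by
    rw [← Matrix.mulVec_mulVec]; rfl
  have h2 : D.mom (fun i => D.R ω i k) = fun j => D.momZR ω j k := by
    ext j
    simp [mom, momZR, Matrix.mul_apply, Matrix.mulVec, dotProduct]
  rw [h1, D.dotProduct_projMat_mulVec hn hS, h2, Pi.smul_apply, smul_eq_mul,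
    ← Matrix.mulVec_mulVec]
  rfl

lemma R_transpose_mul_projMat_mul_R (hn : n ≠ 0) (hS : IsUnit D.momZZ.det) (ω : Finset (Fin p)) :
    (D.R ω)ᵀ * projMat D.Z * D.R ω = (n : ℝ) • D.gram ω := by
  refine Matrix.ext_of_mulVec_single fun k => ?_
  rw [← Matrix.mulVec_mulVec, D.R_transpose_mul_projMat hn hS, mom_R_mulVec, gram,
    Matrix.smul_mulVec, Matrix.mulVec_mulVec]

lemma thetaHat_eq (hn : n ≠ 0) (hS : IsUnit D.momZZ.det) {ω : Finset (Fin p)}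
    (hG : IsUnit (D.gram ω).det) :
    D.thetaHat ω = (D.gram ω)⁻¹ *ᵥ (((D.momZR ω)ᵀ * D.momZZ⁻¹) *ᵥ D.mom D.y) := by
  have hn' : (n : ℝ) ≠ 0 := Nat.cast_ne_zero.2 hn
  have hinv : ((D.R ω)ᵀ * projMat D.Z * D.R ω)⁻¹ = (n : ℝ)⁻¹ • (D.gram ω)⁻¹ := by
    refine Matrix.inv_eq_left_inv ?_
    rw [D.R_transpose_mul_projMat_mul_R hn hS, Matrix.smul_mul, Matrix.mul_smul, smul_smul,
      inv_mul_cancel₀ hn', one_smul, Matrix.nonsing_inv_mul _ hG]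
  rw [thetaHat, ← Matrix.mulVec_mulVec, hinv, D.R_transpose_mul_projMat hn hS, Matrix.smul_mulVec,
    Matrix.mulVec_smul, smul_smul, inv_mul_cancel₀ hn', one_smul]

/-- The quadratic expansion of the two-stage least squares criterion at its minimiser. -/
lemma projNormSq_sub (hn : n ≠ 0) (hS : IsUnit D.momZZ.det) {ω : Finset (Fin p)}
    (hG : IsUnit (D.gram ω).det) (θ : Option ω → ℝ) :
    D.projNormSq (D.y - D.R ω *ᵥ θ) = D.projNormSq (D.y - D.yHat ω) +
      n * ((θ - D.thetaHat ω) ⬝ᵥ (D.gram ω *ᵥ (θ - D.thetaHat ω))) := by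
  set δ := θ - D.thetaHat ω with hδ
  set e := D.mom D.y - D.momZR ω *ᵥ D.thetaHat ω with he
  have h1 : D.mom (D.y - D.R ω *ᵥ θ) = e - D.momZR ω *ᵥ δ := by
    rw [mom_sub, mom_R_mulVec, he, hδ, Matrix.mulVec_sub]; abel
  have h2 : D.mom (D.y - D.yHat ω) = e := by rw [mom_sub, yHat, mom_R_mulVec]
  -- The normal equations at the estimator; they remove both cross terms of the expansion.
  have horth : ((D.momZR ω)ᵀ * D.momZZ⁻¹) *ᵥ e = 0 := by
    rw [he, Matrix.mulVec_sub, Matrix.mulVec_mulVec _ _ (D.momZR ω), ← gram,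
      D.thetaHat_eq hn hS hG, Matrix.mulVec_mulVec _ (D.gram ω), Matrix.mul_nonsing_inv _ hG,
      Matrix.one_mulVec, sub_self]
  have hc1 : (D.momZR ω *ᵥ δ) ⬝ᵥ (D.momZZ⁻¹ *ᵥ e) = 0 := by
    rw [dotProduct_comm, Matrix.dotProduct_mulVec, ← Matrix.mulVec_transpose,
      Matrix.mulVec_mulVec, horth, zero_dotProduct]
  have hc2 : e ⬝ᵥ (D.momZZ⁻¹ *ᵥ (D.momZR ω *ᵥ δ)) = 0 := by
    rw [Matrix.dotProduct_mulVec, ← Matrix.mulVec_transpose, Matrix.transpose_nonsing_inv,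
      momZZ_transpose, dotProduct_comm, hc1]
  have hq : (D.momZR ω *ᵥ δ) ⬝ᵥ (D.momZZ⁻¹ *ᵥ (D.momZR ω *ᵥ δ)) = δ ⬝ᵥ (D.gram ω *ᵥ δ) := by
    rw [dotProduct_comm, Matrix.dotProduct_mulVec, ← Matrix.mulVec_transpose,
      Matrix.mulVec_mulVec, Matrix.mulVec_mulVec, gram, dotProduct_comm]
  rw [D.projNormSq_eq hn hS, D.projNormSq_eq hn hS, h1, h2, Matrix.mulVec_sub _ e, sub_dotProduct,
    dotProduct_sub, dotProduct_sub, hc1, hc2, hq]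
  ring

/-- Since Zᵀ P_Z = Zᵀ, the fitted exposure has the same instrument moments as `d`. Numerator and
denominator of `tsls` are therefore values of one Schur functional, at the moments of `y` and of
`d`. -/
lemma dHat_dotProduct_one_sub_projMat (hn : n ≠ 0) (hS : IsUnit D.momZZ.det) (ω : Finset (Fin p))
    (v : Fin n → ℝ) :
    D.dHat ⬝ᵥ ((1 - projMat (D.Zsub ω)) *ᵥ v) =
      n * schurCompl D.momZZ (D.mom D.d) ω (D.mom v) := by
  have hn' : (n : ℝ) ≠ 0 := Nat.cast_ne_zero.2 hn
  have hsub : ∀ u : Fin n → ℝ, (D.Zsub ω)ᵀ *ᵥ u = (n : ℝ) • fun j : ω => D.mom u j := by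
    intro u
    ext j
    exact congrFun (D.transpose_mulVec_eq hn u) j
  have hdm : D.mom D.dHat = D.mom D.d := by
    rw [mom, mom, dHat, Matrix.mulVec_mulVec]
    congr 2
    rw [← D.projMat_transpose, ← Matrix.transpose_mul, D.projMat_mul_Z hn hS]
  have hinv : ((D.Zsub ω)ᵀ * D.Zsub ω)⁻¹ = (n : ℝ)⁻¹ • (D.momZZ.submatrix
      (fun j : ω => (j : Fin p)) (fun j : ω => (j : Fin p)))⁻¹ := by
    have hu : IsUnit (D.momZZ.submatrix
      (fun j : ω => (j : Fin p)) (fun j : ω => (j : Fin p))).det :=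
      (Matrix.isUnit_iff_isUnit_det _).1
        ((D.momZZ_posDef hS).submatrix Subtype.val_injective).isUnit
    have h : (D.Zsub ω)ᵀ * D.Zsub ω = (n : ℝ) • D.momZZ.submatrix
        (fun j : ω => (j : Fin p)) (fun j : ω => (j : Fin p)) := by
      ext j k
      simp [momZZ, Matrix.mul_apply, Zsub, hn']
    refine Matrix.inv_eq_left_inv ?_
    rw [h, Matrix.smul_mul, Matrix.mul_smul, smul_smul, inv_mul_cancel₀ hn', one_smul,
      Matrix.nonsing_inv_mul _ hu]
  have h1 : D.dHat ⬝ᵥ v = n * (D.mom D.d ⬝ᵥ (D.momZZ⁻¹ *ᵥ D.mom v)) := by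
    rw [← D.dotProduct_projMat_mulVec hn hS, Matrix.dotProduct_mulVec, ← Matrix.mulVec_transpose,
      projMat_transpose, dHat]
  have h2 : D.dHat ⬝ᵥ (projMat (D.Zsub ω) *ᵥ v) = n * ((fun j : ω => D.mom D.d j) ⬝ᵥ
      ((D.momZZ.submatrix (fun j : ω => (j : Fin p)) (fun j : ω => (j : Fin p)))⁻¹ *ᵥ
        fun j : ω => D.mom v j)) := by
    rw [projMat, ← Matrix.mulVec_mulVec, ← Matrix.mulVec_mulVec, Matrix.dotProduct_mulVec,
      ← Matrix.mulVec_transpose, hsub, hsub, hdm, hinv, Matrix.mulVec_smul, Matrix.smul_mulVec,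
      smul_smul, mul_inv_cancel₀ hn', one_smul, smul_dotProduct, smul_eq_mul]
  rw [Matrix.sub_mulVec, Matrix.one_mulVec, dotProduct_sub, h1, h2, schurCompl, mul_sub]

/-- The two-stage least squares estimator of `β` is the `β` coordinate of `θ̂_ω`
(Frisch–Waugh–Lovell). -/
lemma tsls_eq_thetaHat_none (hn : n ≠ 0) (hS : IsUnit D.momZZ.det) {ω : Finset (Fin p)}
    (hG : IsUnit (D.gram ω).det) : D.tsls ω = D.thetaHat ω none := by
  have hn' : (n : ℝ) ≠ 0 := Nat.cast_ne_zero.2 hn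
  have hdm : D.mom D.dHat = D.mom D.d := by
    rw [mom, mom, dHat, Matrix.mulVec_mulVec]
    congr 2
    rw [← D.projMat_transpose, ← Matrix.transpose_mul, D.projMat_mul_Z hn hS]
  have hG' := hG
  rw [gram_eq] at hG'
  have h0 : schurCompl D.momZZ (D.mom D.d) ω (D.mom D.d) ≠ 0 :=
    left_ne_zero_of_mul_eq_one (schurCompl_mul_inv (D.momZZ_posDef hS) hG')
  rw [tsls, D.dHat_dotProduct_one_sub_projMat hn hS, D.dHat_dotProduct_one_sub_projMat hn hS, hdm,
    schurCompl_eq_mul (D.momZZ_posDef hS) hG' (D.mom D.y), D.thetaHat_eq hn hS hG, momZR_eq,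
    gram_eq]
  field_simp

end IVData

/-! ### Gaussian integrals and one-dimensional marginals. -/

section Gaussian

open scoped MatrixOrder in
lemma Matrix.PosDef.exists_transpose_mul_self {κ : Type*} [Fintype κ] [DecidableEq κ]
    {H : Matrix κ κ ℝ} (hH : H.PosDef) : ∃ B : Matrix κ κ ℝ, H = Bᵀ * B := by
  obtain ⟨B, hB⟩ := CStarAlgebra.nonneg_iff_eq_star_mul_self.mp hH.posSemidef.nonneg
  exact ⟨B, by rw [hB, Matrix.star_eq_conjTranspose,
    Matrix.conjTranspose_eq_transpose_of_trivial]⟩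

lemma integrable_and_integral_exp_neg_half_sum_sq (κ : Type*) [Fintype κ] :
    Integrable (fun x : κ → ℝ => Real.exp (-(1 / 2) * (x ⬝ᵥ x))) ∧
      ∫ x : κ → ℝ, Real.exp (-(1 / 2) * (x ⬝ᵥ x)) = √(2 * Real.pi) ^ Fintype.card κ := by
  have h : (fun x : κ → ℝ => Real.exp (-(1 / 2) * (x ⬝ᵥ x))) =
      fun x => ∏ i, Real.exp (-(1 / 2) * x i ^ 2) := by
    ext x
    rw [← Real.exp_sum, dotProduct, Finset.mul_sum]
    simp only [sq]
  rw [h]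
  refine ⟨Integrable.fintype_prod fun _ => integrable_exp_neg_mul_sq (by norm_num), ?_⟩
  rw [integral_fintype_prod_volume_eq_pow (fun x : ℝ => Real.exp (-(1 / 2) * x ^ 2)),
    integral_gaussian]
  congr 2
  ring

/-- The multivariate Gaussian integral. -/
lemma integrable_and_integral_exp_neg_half_quadratic {κ : Type*} [Fintype κ] [DecidableEq κ]
    {H : Matrix κ κ ℝ} (hH : H.PosDef) (m : κ → ℝ) :
    Integrable (fun x : κ → ℝ => Real.exp (-(1 / 2) * ((x - m) ⬝ᵥ (H *ᵥ (x - m))))) ∧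
      ∫ x : κ → ℝ, Real.exp (-(1 / 2) * ((x - m) ⬝ᵥ (H *ᵥ (x - m)))) =
        √(2 * Real.pi) ^ Fintype.card κ / √H.det := by
  obtain ⟨B, rfl⟩ := hH.exists_transpose_mul_self
  have hdet : (Bᵀ * B).det = B.det ^ 2 := by rw [Matrix.det_mul, Matrix.det_transpose, sq]
  have hB : B.det ≠ 0 := fun h => hH.det_pos.ne' (by rw [hdet, h]; norm_num)
  set g : (κ → ℝ) → ℝ := fun x => Real.exp (-(1 / 2) * (x ⬝ᵥ x)) with hg
  have hcomp : (fun x : κ → ℝ => Real.exp (-(1 / 2) * (x ⬝ᵥ ((Bᵀ * B) *ᵥ x)))) =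
      fun x => g (Matrix.toLin' B x) := by
    ext x
    rw [hg, Matrix.toLin'_apply, ← Matrix.mulVec_mulVec, Matrix.dotProduct_mulVec,
      ← Matrix.mulVec_transpose, Matrix.transpose_transpose]
  have hmeas : AEMeasurable (Matrix.toLin' B) (volume : Measure (κ → ℝ)) :=
    (LinearMap.continuous_of_finiteDimensional _).aemeasurable
  obtain ⟨hint, hval⟩ := integrable_and_integral_exp_neg_half_sum_sq κ
  have hmap := Real.map_matrix_volume_pi_eq_smul_volume_pi hB
  have hint' : Integrable g (Measure.map (Matrix.toLin' B) volume) := by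
    rw [hmap]; exact hint.smul_measure ENNReal.ofReal_ne_top
  have h0 : Integrable (fun x : κ → ℝ => Real.exp (-(1 / 2) * (x ⬝ᵥ ((Bᵀ * B) *ᵥ x)))) := by
    rw [hcomp]; exact hint'.comp_aemeasurable hmeas
  refine ⟨h0.comp_sub_right m, ?_⟩
  -- Translate by `m`, then substitute through the factor `B` of `H = Bᵀ * B`; the Jacobian |det
  -- B|⁻¹ is 1 / √det H.
  rw [integral_sub_right_eq_self
    (fun x : κ → ℝ => Real.exp (-(1 / 2) * (x ⬝ᵥ ((Bᵀ * B) *ᵥ x)))) m, hcomp,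
    ← integral_map hmeas hint'.aestronglyMeasurable, hmap, integral_smul_measure, hval, hdet,
    Real.sqrt_sq_eq_abs, ENNReal.toReal_ofReal (abs_nonneg _), abs_inv, smul_eq_mul]
  ring

/-- Completing the square at a distinguished coordinate. -/
lemma Matrix.quadratic_eq_sq_div_add {κ : Type*} [Fintype κ] [DecidableEq κ]
    {H : Matrix (Option κ) (Option κ) ℝ} (hH : H.PosDef) (x : Option κ → ℝ) :
    x ⬝ᵥ (H *ᵥ x) = x none ^ 2 / H⁻¹ none none +
      (x - (x none / H⁻¹ none none) • H⁻¹.col none) ⬝ᵥ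
        (H *ᵥ (x - (x none / H⁻¹ none none) • H⁻¹.col none)) := by
  have hu : IsUnit H.det := (Matrix.isUnit_iff_isUnit_det _).1 hH.isUnit
  have hτ : H⁻¹ none none ≠ 0 := hH.inv.diag_pos.ne'
  have hsymm : Hᵀ = H := hH.1
  set v := H⁻¹.col none with hv
  -- The column `v` of `H⁻¹` is `H`-orthogonal to all vectors vanishing at `none`, so subtracting
  -- the right multiple of it splits the quadratic form.
  have hHv : H *ᵥ v = Pi.single none 1 := by
    rw [hv, ← Matrix.mulVec_single_one, Matrix.mulVec_mulVec, Matrix.mul_nonsing_inv _ hu,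
      Matrix.one_mulVec]
  have hv0 : v none = H⁻¹ none none := rfl
  have h1 : v ⬝ᵥ (H *ᵥ x) = x none := by
    rw [Matrix.dotProduct_mulVec, ← Matrix.mulVec_transpose, hsymm, hHv, single_dotProduct, one_mul]
  rw [Matrix.mulVec_sub, Matrix.mulVec_smul, sub_dotProduct, dotProduct_sub, dotProduct_sub, hHv,
    smul_dotProduct, h1, smul_dotProduct, dotProduct_smul, dotProduct_smul,
    dotProduct_single, dotProduct_single, hv0]
  simp only [smul_eq_mul]
  field_simp
  ring

/-- The marginal of a multivariate Gaussian density at a distinguished coordinate, up to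
normalisation. -/
lemma map_none_withDensity_exp_quadratic {κ : Type*} [Fintype κ] [DecidableEq κ]
    {H : Matrix (Option κ) (Option κ) ℝ} (hH : H.PosDef) (m : Option κ → ℝ) (K : ℝ) (hK : 0 ≤ K) :
    ∃ C : ENNReal, ((volume : Measure (Option κ → ℝ)).withDensity fun θ =>
      ENNReal.ofReal (K * Real.exp (-(1 / 2) * ((θ - m) ⬝ᵥ (H *ᵥ (θ - m)))))).map
        (fun θ => θ none) = C • gaussianReal (m none) (H⁻¹ none none).toNNReal := by
  set τ := H⁻¹ none none with hτ
  have hτ0 : 0 < τ := hH.inv.diag_pos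
  have hv : τ.toNNReal ≠ 0 := by simpa using hτ0
  set F : (κ → ℝ) → ENNReal := fun a =>
    ENNReal.ofReal (Real.exp (-(1 / 2) * ((fun k : Option κ => k.elim 0 a) ⬝ᵥ
      (H *ᵥ fun k : Option κ => k.elim 0 a)))) with hF
  have hcont : Continuous fun a : κ → ℝ => (fun k : Option κ => k.elim 0 a) := by
    refine continuous_pi fun k => ?_
    rcases k with _ | k
    · exact continuous_const
    · exact continuous_apply k
  have hFm : Measurable F := by
    refine (ENNReal.continuous_ofReal.comp (Real.continuous_exp.comp ?_)).measurable
    exact continuous_const.mul (Continuous.dotProduct hcont (continuous_const.matrix_mulVec hcont))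
  have hfm : Measurable fun θ : Option κ → ℝ =>
      ENNReal.ofReal (K * Real.exp (-(1 / 2) * ((θ - m) ⬝ᵥ (H *ᵥ (θ - m))))) := by
    have hc : Continuous fun θ : Option κ → ℝ => θ - m := by fun_prop
    refine (ENNReal.continuous_ofReal.comp (continuous_const.mul
      (Real.continuous_exp.comp ?_))).measurable
    exact continuous_const.mul (Continuous.dotProduct hc (continuous_const.matrix_mulVec hc))
  -- The root undoes the normalisation of the one-dimensional density, and the integral of `F` is
  -- the mass of the conditional Gaussian factor. Its value is never computed: total mass one fixes
  -- the constant later.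
  refine ⟨ENNReal.ofReal (K * √(2 * Real.pi * τ)) * ∫⁻ a, F a, ?_⟩
  ext B hB
  have hnone : Measurable fun θ : Option κ → ℝ => θ none := measurable_pi_apply none
  rw [Measure.map_apply hnone hB, withDensity_apply _ (hnone hB),
    ← lintegral_indicator (hnone hB)]
  have hpi := Measure.pi_map_piOptionEquivProd (β := fun _ : Option κ => ℝ) fun _ => volume
  rw [volume_pi, ← hpi, lintegral_map_equiv, lintegral_prod_symm']
  · have hin : ∀ b : ℝ, ∫⁻ a : κ → ℝ, ((fun θ : Option κ → ℝ => θ none) ⁻¹' B).indicator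
        (fun θ => ENNReal.ofReal (K * Real.exp (-(1 / 2) * ((θ - m) ⬝ᵥ (H *ᵥ (θ - m))))))
          ((MeasurableEquiv.piOptionEquivProd fun _ : Option κ => ℝ).symm (a, b))
          ∂(Measure.pi fun _ : κ => (volume : Measure ℝ)) =
        B.indicator (fun b => (ENNReal.ofReal (K * √(2 * Real.pi * τ)) * ∫⁻ a, F a) *
          gaussianPDF (m none) τ.toNNReal b) b := by
      intro b
      by_cases hb : b ∈ B
      · rw [Set.indicator_of_mem hb]
        -- The conditional mean of the remaining coordinates given that the distinguished one equals
        -- `b`. Translation invariance makes the inner integral independent of it.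
        set c : κ → ℝ := fun k => m (some k) + (b - m none) / τ * H⁻¹ (some k) none with hc
        have hpt : ∀ a : κ → ℝ, ((fun θ : Option κ → ℝ => θ none) ⁻¹' B).indicator
            (fun θ => ENNReal.ofReal (K * Real.exp (-(1 / 2) * ((θ - m) ⬝ᵥ (H *ᵥ (θ - m))))))
            ((MeasurableEquiv.piOptionEquivProd fun _ : Option κ => ℝ).symm (a, b)) =
            ENNReal.ofReal (K * √(2 * Real.pi * τ)) * gaussianPDF (m none) τ.toNNReal b *
              F (a - c) := by
          intro a
          set θ := (MeasurableEquiv.piOptionEquivProd fun _ : Option κ => ℝ).symm (a, b) with hθ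
          have hθ0 : θ none = b := rfl
          have hθ1 : ∀ k, θ (some k) = a k := fun k => rfl
          rw [Set.indicator_of_mem (by simpa [hθ0] using hb), Matrix.quadratic_eq_sq_div_add hH]
          have hx : θ - m - ((θ - m) none / H⁻¹ none none) • H⁻¹.col none =
              fun k : Option κ => k.elim 0 (a - c) := by
            ext k
            rcases k with _ | k
            · have : H⁻¹ none none ≠ 0 := hτ0.ne'
              simp [Matrix.col_apply, this]
            · simp [hθ1, hθ0, hc, Matrix.col_apply, ← hτ]
              ring
          rw [hx, hF, gaussianPDF, gaussianPDFReal, ← ENNReal.ofReal_mul (by positivity),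
            ← ENNReal.ofReal_mul (by positivity)]
          congr 1
          rw [mul_add, Real.exp_add, Real.coe_toNNReal _ hτ0.le, ← hτ]
          have hs : √(2 * Real.pi * τ) ≠ 0 := by positivity
          have he : (-(1 / 2) * ((θ - m) none ^ 2 / τ)) = -(b - m none) ^ 2 / (2 * τ) := by
            simp only [Pi.sub_apply, hθ0]
            field_simp
          rw [he]
          field_simp
        have hFc : Measurable fun a => F (a - c) := hFm.comp (measurable_id.sub_const c)
        simp_rw [hpt]
        rw [lintegral_const_mul _ hFc, ← volume_pi,
          lintegral_sub_right_eq_self F c]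
        ring
      · rw [Set.indicator_of_notMem hb]
        exact (lintegral_congr (g := fun _ => 0) fun a => Set.indicator_of_notMem
          (s := (fun θ : Option κ → ℝ => θ none) ⁻¹' B) (fun h => hb h) _).trans (by simp)
    simp_rw [hin]
    rw [lintegral_indicator hB, lintegral_const_mul _ (measurable_gaussianPDF _ _),
      Measure.smul_apply, gaussianReal_apply _ hv, smul_eq_mul]
  · exact (hfm.indicator (hnone hB)).comp
      (MeasurableEquiv.measurable _)

end Gaussian

/-! ### Closed forms of the marginal pseudo-likelihood and the posterior. -/

namespace IVData

variable {n p : ℕ} (D : IVData n p)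

/-- The nondegeneracy conditions under which the posterior in the model `ω` is Gaussian. -/
structure Regular (ω : Finset (Fin p)) : Prop where
  n_ne_zero : n ≠ 0
  momZZ_det : IsUnit D.momZZ.det
  gram_det : IsUnit (D.gram ω).det
  sigma_pos : 0 < D.sigmaHatSq ω

/-- The posterior precision matrix of `θ_ω`. -/
def precision (ω : Finset (Fin p)) : Matrix (Option ω) (Option ω) ℝ :=
  ((n : ℝ) / D.sigmaHatSq ω) • D.gram ω

/-- The maximum of the pseudo-likelihood of the model `ω`. -/
def maxLik (ω : Finset (Fin p)) : ℝ :=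
  1 / ((2 * Real.pi * D.sigmaHatSq ω) ^ ((p : ℝ) / 2) * √D.momZZ.det) *
    Real.exp (-(1 / 2) * D.misfit ω)

namespace Regular

variable {D} {ω : Finset (Fin p)} (h : D.Regular ω)
include h

lemma precision_posDef : (D.precision ω).PosDef :=
  (D.gram_posDef h.gram_det).smul
    (div_pos (Nat.cast_pos.2 (Nat.pos_of_ne_zero h.n_ne_zero)) h.sigma_pos)

lemma maxLik_pos : 0 < D.maxLik ω := by
  have h1 := h.sigma_pos
  have h2 := (D.momZZ_posDef h.momZZ_det).det_pos
  rw [maxLik]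
  positivity

lemma pseudoLik_eq (θ : Option ω → ℝ) :
    D.pseudoLik ω θ = D.maxLik ω * Real.exp (-(1 / 2) *
      ((θ - D.thetaHat ω) ⬝ᵥ (D.precision ω *ᵥ (θ - D.thetaHat ω)))) := by
  have h1 := h.sigma_pos.ne'
  rw [pseudoLik, maxLik, D.projNormSq_sub h.n_ne_zero h.momZZ_det h.gram_det, mul_assoc (_ / _),
    ← Real.exp_add, ← momZZ, precision, Matrix.smul_mulVec, dotProduct_smul, smul_eq_mul, misfit]
  congr 2
  field_simp
  ring

lemma margLik_eq : D.margLik ω =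
    D.maxLik ω * (√(2 * Real.pi) ^ (1 + ω.card) / √(D.precision ω).det) := by
  rw [margLik]
  simp_rw [h.pseudoLik_eq]
  rw [integral_const_mul,
    (integrable_and_integral_exp_neg_half_quadratic h.precision_posDef _).2]
  simp [add_comm]

lemma margLik_pos : 0 < D.margLik ω := by
  have h1 := h.maxLik_pos
  have h2 := h.precision_posDef.det_pos
  rw [h.margLik_eq]
  positivity

lemma isProbabilityMeasure_postTheta : IsProbabilityMeasure (D.postTheta ω) := by
  have hint := ((integrable_and_integral_exp_neg_half_quadratic h.precision_posDef
    (D.thetaHat ω)).1.const_mul (D.maxLik ω)).div_const (D.margLik ω)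
  refine ⟨?_⟩
  rw [postTheta, withDensity_apply _ MeasurableSet.univ, Measure.restrict_univ,
    ← ofReal_integral_eq_lintegral_ofReal, integral_div, ← margLik, div_self h.margLik_pos.ne',
    ENNReal.ofReal_one]
  · simpa only [h.pseudoLik_eq] using hint
  · refine ae_of_all _ fun θ => ?_
    have h1 := h.margLik_pos
    have h2 := h.maxLik_pos
    simp only [h.pseudoLik_eq, Pi.zero_apply]
    positivity

/-- The posterior of `β` in the model `ω` is Gaussian, centred at the two-stage least squares
estimator. -/
lemma postBeta_eq : D.postBeta ω = gaussianReal (D.tsls ω)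
    (D.sigmaHatSq ω / n * (D.gram ω)⁻¹ none none).toNNReal := by
  have h1 := h.margLik_pos
  have h2 := h.maxLik_pos
  have hn : (n : ℝ) ≠ 0 := Nat.cast_ne_zero.2 h.n_ne_zero
  obtain ⟨C, hC⟩ := map_none_withDensity_exp_quadratic h.precision_posDef (D.thetaHat ω)
    (D.maxLik ω / D.margLik ω) (by positivity)
  have hinv : (D.precision ω)⁻¹ none none = D.sigmaHatSq ω / n * (D.gram ω)⁻¹ none none := by
    have : (D.precision ω)⁻¹ = (D.sigmaHatSq ω / n) • (D.gram ω)⁻¹ := by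
      refine Matrix.inv_eq_left_inv ?_
      have := h.sigma_pos.ne'
      rw [precision, Matrix.smul_mul, Matrix.mul_smul, smul_smul,
        Matrix.nonsing_inv_mul _ h.gram_det, div_mul_div_cancel₀ hn, div_self this, one_smul]
    rw [this, Matrix.smul_apply, smul_eq_mul]
  have hpost : D.postBeta ω = C • gaussianReal (D.tsls ω)
      (D.sigmaHatSq ω / n * (D.gram ω)⁻¹ none none).toNNReal := by
    rw [D.tsls_eq_thetaHat_none h.n_ne_zero h.momZZ_det h.gram_det, ← hinv, ← hC, postBeta,
      postTheta]
    simp_rw [h.pseudoLik_eq, mul_div_right_comm]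
  have hone : D.postBeta ω Set.univ = 1 := by
    have := h.isProbabilityMeasure_postTheta
    have hm : Measurable fun θ : Option ω → ℝ => θ none := measurable_pi_apply none
    rw [postBeta, Measure.map_apply hm MeasurableSet.univ, Set.preimage_univ, measure_univ]
  -- The undetermined constant of the marginalisation is the total mass of the posterior.
  have hC1 : C = 1 := by
    rw [hpost, Measure.smul_apply, measure_univ, smul_eq_mul, mul_one] at hone
    exact hone
  rw [hpost, hC1, one_smul]

/-- The exact form of the BIC expansion. Pulling n / σ̂² out of the precision determinant raises it
to the power 1 + |ω|, which produces the log n penalty; the other terms on the right have finite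
limits. -/
lemma two_mul_log_margLik_add_misfit : 2 * Real.log (D.margLik ω) + D.misfit ω =
    (1 + ω.card - p) * Real.log (2 * Real.pi * D.sigmaHatSq ω) - Real.log D.momZZ.det -
      Real.log (D.gram ω).det - (1 + ω.card) * Real.log n := by
  have h1 := h.sigma_pos
  have h2 := (D.momZZ_posDef h.momZZ_det).det_pos
  have h3 := (D.gram_posDef h.gram_det).det_pos
  have hn : (0 : ℝ) < n := Nat.cast_pos.2 (Nat.pos_of_ne_zero h.n_ne_zero)
  have hpi := Real.pi_pos
  have hdet : (D.precision ω).det =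
      ((n : ℝ) / D.sigmaHatSq ω) ^ (1 + ω.card) * (D.gram ω).det := by
    rw [precision, Matrix.det_smul]
    simp [add_comm]
  rw [h.margLik_eq, maxLik, hdet]
  rw [Real.log_mul (by positivity) (by positivity), Real.log_mul (by positivity) (by positivity),
    Real.log_exp, Real.log_div one_ne_zero (by positivity), Real.log_one,
    Real.log_mul (by positivity) (by positivity), Real.log_rpow (by positivity),
    Real.log_sqrt h2.le, Real.log_div (by positivity) (by positivity), Real.log_pow,
    Real.log_sqrt (by positivity), Real.log_sqrt (by positivity),
    Real.log_mul (by positivity) h3.ne', Real.log_pow, Real.log_div hn.ne' h1.ne',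
    Real.log_mul (by positivity) h1.ne']
  push_cast
  ring

end Regular

end IVData

/-! ### Convergence in probability as convergence along a filter. -/

section ProbFilter

variable {Ω : Type*} [MeasurableSpace Ω]

/-- The filter of events in `ℕ × Ω` whose `n`-th section has probability tending to one: convergence
in probability is convergence along this filter. -/
def probFilter (μ : Measure Ω) : Filter (ℕ × Ω) where
  sets := {s | Tendsto (fun n => μ {w | (n, w) ∉ s}) atTop (𝓝 0)}
  univ_sets := by simp
  sets_of_superset {s t} hs hst :=
    tendsto_of_tendsto_of_tendsto_of_le_of_le tendsto_const_nhds hs (fun _ => zero_le)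
      fun _ => measure_mono fun _ hw h => hw (hst h)
  inter_sets {s t} hs ht := by
    refine tendsto_of_tendsto_of_tendsto_of_le_of_le tendsto_const_nhds
      (by simpa using Tendsto.add hs ht) (fun _ => zero_le) fun n => ?_
    refine (measure_mono fun w hw => ?_).trans (measure_union_le _ _)
    by_contra h
    simp only [Set.mem_union, Set.mem_ofPred_eq, not_or, not_not] at h
    exact hw ⟨h.1, h.2⟩

variable {μ : Measure Ω}

lemma mem_probFilter {s : Set (ℕ × Ω)} :
    s ∈ probFilter μ ↔ Tendsto (fun n => μ {w | (n, w) ∉ s}) atTop (𝓝 0) := Iff.rfl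

/-- Both sides say that the probability of being at distance at least ε from `c` tends to 0. No
measurability is involved, so it also applies to total variation distances and posterior
probabilities. -/
lemma tendstoInMeasure_const_iff {f : ℕ → Ω → ℝ} {c : ℝ} :
    TendstoInMeasure μ f atTop (fun _ => c) ↔
      Tendsto (fun x : ℕ × Ω => f x.1 x.2) (probFilter μ) (𝓝 c) := by
  rw [tendstoInMeasure_iff_dist, Metric.tendsto_nhds]
  refine forall₂_congr fun ε _ => ?_
  rw [Filter.Eventually, mem_probFilter]
  simp

lemma tendsto_fst_probFilter : Tendsto Prod.fst (probFilter μ) atTop := by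
  refine tendsto_atTop.2 fun N => ?_
  rw [Filter.Eventually, mem_probFilter]
  refine tendsto_const_nhds.congr' ?_
  filter_upwards [eventually_ge_atTop N] with n hn
  simp [hn]

/-- A sequence tending to zero in probability times a sequence bounded in `L²` tends to zero in
probability. -/
lemma tendsto_mul_probFilter_of_bounded_sq {U a : ℕ → Ω → ℝ} {C : ENNReal} (hC : C ≠ ⊤)
    (hU : ∀ n, AEMeasurable (U n) μ) (hb : ∀ n, ∫⁻ w, ENNReal.ofReal (U n w ^ 2) ∂μ ≤ C)
    (ha : Tendsto (fun x : ℕ × Ω => a x.1 x.2) (probFilter μ) (𝓝 0)) :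
    Tendsto (fun x : ℕ × Ω => a x.1 x.2 * U x.1 x.2) (probFilter μ) (𝓝 0) := by
  rw [Metric.tendsto_nhds] at ha ⊢
  intro ε hε
  rw [Filter.Eventually, mem_probFilter, ENNReal.tendsto_nhds_zero]
  intro δ hδ
  -- A Chebyshev cutoff: uniformly in `n`, the event |U_n| ≥ K has probability at most δ / 2. Off
  -- that event it is enough that |a| < ε / K.
  obtain ⟨K, hK0, hK⟩ : ∃ K : ℝ, 0 < K ∧ C / ENNReal.ofReal (K ^ 2) ≤ δ / 2 := by
    have h : Tendsto (fun K : ℝ => C / ENNReal.ofReal (K ^ 2)) atTop (𝓝 0) := by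
      have := ENNReal.Tendsto.const_div (a := C)
        (ENNReal.tendsto_ofReal_atTop.comp (tendsto_pow_atTop (α := ℝ) two_ne_zero)) (Or.inr hC)
      simpa using this
    have h2 := ENNReal.tendsto_nhds_zero.1 h (δ / 2) (ENNReal.half_pos hδ.ne')
    obtain ⟨K, h3, h4⟩ := (h2.and (eventually_gt_atTop 0)).exists
    exact ⟨K, h4, h3⟩
  have h1 := ha (ε / K) (by positivity)
  rw [Filter.Eventually, mem_probFilter, ENNReal.tendsto_nhds_zero] at h1
  filter_upwards [h1 (δ / 2) (ENNReal.half_pos hδ.ne')] with n hn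
  have h2 : μ {w | ENNReal.ofReal (K ^ 2) ≤ ENNReal.ofReal (U n w ^ 2)} ≤ δ / 2 := by
    have hm : AEMeasurable (fun w => ENNReal.ofReal (U n w ^ 2)) μ :=
      ((hU n).pow_const 2).ennreal_ofReal
    refine (meas_ge_le_lintegral_div hm (by simpa using hK0.ne') ENNReal.ofReal_ne_top).trans ?_
    exact (ENNReal.div_le_div_right (hb n) _).trans hK
  calc _ ≤ μ ({w | (n, w) ∉ {x : ℕ × Ω | dist (a x.1 x.2) 0 < ε / K}} ∪
        {w | ENNReal.ofReal (K ^ 2) ≤ ENNReal.ofReal (U n w ^ 2)}) := by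
        refine measure_mono fun w hw => ?_
        by_contra h
        simp only [Set.mem_union, Set.mem_ofPred_eq, not_or, dist_zero_right,
          Real.norm_eq_abs, not_lt, not_le] at h hw
        have h3 : U n w ^ 2 < K ^ 2 := (ENNReal.ofReal_lt_ofReal_iff (by positivity)).1 h.2
        have h4 : |U n w| < K := by
          simpa [abs_of_pos hK0] using sq_lt_sq.1 h3
        rw [abs_mul] at hw
        have : |a n w| * |U n w| < ε / K * K :=
          mul_lt_mul'' h.1 h4 (abs_nonneg _) (abs_nonneg _)
        rw [div_mul_cancel₀ _ hK0.ne'] at this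
        linarith
    _ ≤ δ / 2 + δ / 2 := (measure_union_le _ _).trans (add_le_add hn h2)
    _ = δ := ENNReal.add_halves δ

end ProbFilter

/-! ### Total variation, mixtures and centred Gaussian laws. -/

section TotalVariation

variable {E : Type*} [MeasurableSpace E]

lemma tvDistance_nonneg (P Q : Measure E) : 0 ≤ tvDistance P Q :=
  Real.iSup_nonneg fun _ => abs_nonneg _

lemma tvDistance_le {P Q : Measure E} {c : ℝ}
    (h : ∀ B, MeasurableSet B → |P.real B - Q.real B| ≤ c) : tvDistance P Q ≤ c :=
  haveI : Nonempty {B : Set E // MeasurableSet B} := ⟨⟨∅, MeasurableSet.empty⟩⟩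
  ciSup_le fun B => h B.1 B.2

/-- Finiteness of the measures bounds the family, without which the real supremum would take its
default value 0. -/
lemma abs_sub_le_tvDistance (P Q : Measure E) [IsFiniteMeasure P] [IsFiniteMeasure Q] {B : Set E}
    (hB : MeasurableSet B) : |P.real B - Q.real B| ≤ tvDistance P Q := by
  refine le_ciSup (f := fun B : {B : Set E // MeasurableSet B} => |P.real B.1 - Q.real B.1|)
    ⟨P.real Set.univ + Q.real Set.univ, ?_⟩ ⟨B, hB⟩
  rintro _ ⟨B, rfl⟩
  refine (abs_sub _ _).trans ?_
  rw [abs_of_nonneg measureReal_nonneg, abs_of_nonneg measureReal_nonneg]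
  exact add_le_add (measureReal_mono (Set.subset_univ _)) (measureReal_mono (Set.subset_univ _))

/-- A mixture is close to a component of large weight. -/
lemma abs_mixture_sub_le {ι : Type*} [DecidableEq ι] {A : Finset ι} {i₀ : ι} (hi₀ : i₀ ∈ A)
    {w : ι → ℝ} (hw : ∀ i ∈ A, 0 ≤ w i) (hsum : ∑ i ∈ A, w i = 1) {ν : ι → Measure E}
    (hν : ∀ i ∈ A, IsProbabilityMeasure (ν i)) (B : Set E) :
    |(∑ i ∈ A, ENNReal.ofReal (w i) • ν i).real B - (ν i₀).real B| ≤ 1 - w i₀ := by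
  have h1 : (∑ i ∈ A, ENNReal.ofReal (w i) • ν i).real B = ∑ i ∈ A, w i * (ν i).real B := by
    rw [Measure.real, Measure.finsetSum_apply, ENNReal.toReal_sum]
    · refine Finset.sum_congr rfl fun i hi => ?_
      rw [Measure.smul_apply, smul_eq_mul, ENNReal.toReal_mul, ENNReal.toReal_ofReal (hw i hi),
        Measure.real]
    · intro i hi
      have := hν i hi
      exact ENNReal.mul_ne_top ENNReal.ofReal_ne_top (measure_ne_top _ _)
  have h2 : (ν i₀).real B = ∑ i ∈ A, w i * (ν i₀).real B := by
    rw [← Finset.sum_mul, hsum, one_mul]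
  rw [h1, h2, ← Finset.sum_sub_distrib, ← Finset.add_sum_erase _ _ hi₀, sub_self, zero_add]
  have h3 : 1 - w i₀ = ∑ i ∈ A.erase i₀, w i := by
    rw [← hsum, ← Finset.add_sum_erase _ _ hi₀, add_sub_cancel_left]
  rw [h3]
  refine (Finset.abs_sum_le_sum_abs _ _).trans (Finset.sum_le_sum fun i hi => ?_)
  have hi' := Finset.mem_of_mem_erase hi
  have := hν i hi'
  have := hν i₀ hi₀
  rw [← mul_sub, abs_mul, abs_of_nonneg (hw i hi')]
  refine mul_le_of_le_one_right (hw i hi') (abs_le.2 ⟨?_, ?_⟩)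
  · linarith [measureReal_nonneg (μ := ν i) (s := B), measureReal_le_one (μ := ν i₀) (s := B)]
  · linarith [measureReal_nonneg (μ := ν i₀) (s := B), measureReal_le_one (μ := ν i) (s := B)]

lemma tvDistance_gaussianReal_le (v v₀ : NNReal) (hv : v ≠ 0) (hv₀ : v₀ ≠ 0) :
    tvDistance (gaussianReal 0 v) (gaussianReal 0 v₀) ≤
      ∫ x, |gaussianPDFReal 0 v x - gaussianPDFReal 0 v₀ x| := by
  refine tvDistance_le fun B hB => ?_
  have h : ∀ u : NNReal, u ≠ 0 → (gaussianReal 0 u).real B = ∫ x in B, gaussianPDFReal 0 u x := by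
    intro u hu
    rw [Measure.real, gaussianReal_apply_eq_integral _ hu, ENNReal.toReal_ofReal]
    exact integral_nonneg fun x => gaussianPDFReal_nonneg _ _ _
  rw [h v hv, h v₀ hv₀, ← integral_sub (integrable_gaussianPDFReal _ _).integrableOn
    (integrable_gaussianPDFReal _ _).integrableOn]
  refine (abs_integral_le_integral_abs).trans ?_
  exact setIntegral_le_integral
    ((integrable_gaussianPDFReal _ _).sub (integrable_gaussianPDFReal _ _)).abs
    (ae_of_all _ fun _ => abs_nonneg _)

/-- The centred Gaussian law depends continuously on its variance in total variation. -/
lemma tendsto_tvDistance_gaussianReal {v₀ : ℝ} (hv₀ : 0 < v₀) :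
    Tendsto (fun v : ℝ => tvDistance (gaussianReal 0 v.toNNReal) (gaussianReal 0 v₀.toNNReal))
      (𝓝 v₀) (𝓝 0) := by
  have hnear : ∀ᶠ v in 𝓝 v₀, v ∈ Set.Ioo (v₀ / 2) (2 * v₀) :=
    Ioo_mem_nhds (by linarith) (by linarith)
  have hint : Tendsto (fun v : ℝ => ∫ x, |gaussianPDFReal 0 v.toNNReal x -
      gaussianPDFReal 0 v₀.toNNReal x|) (𝓝 v₀) (𝓝 (∫ _ : ℝ, (0 : ℝ))) := by
    refine tendsto_integral_filter_of_dominated_convergence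
      -- For variances between `v₀ / 2` and `2 * v₀`, the prefactor is largest at the lower end and
      -- the exponential at the upper end, where 1 / (2v) = 1 / (4v₀).
      (fun x => (√(2 * Real.pi * (v₀ / 2)))⁻¹ * Real.exp (-(1 / (4 * v₀)) * x ^ 2) +
        gaussianPDFReal 0 v₀.toNNReal x) ?_ ?_ ?_ ?_
    · refine Eventually.of_forall fun v => ?_
      exact ((integrable_gaussianPDFReal _ _).sub
        (integrable_gaussianPDFReal _ _)).abs.aestronglyMeasurable
    · filter_upwards [hnear] with v hv
      refine ae_of_all _ fun x => ?_
      have hv0 : 0 < v := by linarith [hv.1]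
      rw [Real.norm_eq_abs, abs_abs]
      refine (abs_sub _ _).trans ?_
      rw [abs_of_nonneg (gaussianPDFReal_nonneg _ _ _), abs_of_nonneg (gaussianPDFReal_nonneg _ _ _)]
      refine add_le_add ?_ le_rfl
      rw [gaussianPDFReal, Real.coe_toNNReal _ hv0.le, sub_zero]
      have h1 : -x ^ 2 / (2 * v) ≤ -(1 / (4 * v₀)) * x ^ 2 := by
        have : 1 / (4 * v₀) ≤ 1 / (2 * v) :=
          one_div_le_one_div_of_le (by linarith) (by linarith [hv.2])
        have := mul_le_mul_of_nonneg_right this (sq_nonneg x)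
        have e : -x ^ 2 / (2 * v) = -(1 / (2 * v) * x ^ 2) := by ring
        rw [e]; linarith
      have h2 : 2 * Real.pi * (v₀ / 2) ≤ 2 * Real.pi * v :=
        mul_le_mul_of_nonneg_left hv.1.le (by positivity)
      gcongr
    · exact ((integrable_exp_neg_mul_sq (by positivity)).const_mul _).add
        (integrable_gaussianPDFReal _ _)
    · refine ae_of_all _ fun x => ?_
      have hc : ContinuousAt (fun v : ℝ => gaussianPDFReal 0 v.toNNReal x) v₀ := by
        have hpos : (0 : ℝ) < v₀.toNNReal := by simpa using hv₀
        have hcont : Continuous fun v : ℝ => ((v.toNNReal : NNReal) : ℝ) := by fun_prop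
        have hpi := Real.pi_pos
        unfold gaussianPDFReal
        refine ContinuousAt.mul (ContinuousAt.inv₀ (by fun_prop) (by positivity)) ?_
        refine Real.continuous_exp.continuousAt.comp (ContinuousAt.div (by fun_prop)
          (by fun_prop) (by positivity))
      have := (hc.tendsto.sub_const (gaussianPDFReal 0 v₀.toNNReal x)).abs
      simpa using this
  rw [integral_zero] at hint
  refine tendsto_of_tendsto_of_tendsto_of_le_of_le' tendsto_const_nhds hint
    (Eventually.of_forall fun _ => tvDistance_nonneg _ _) ?_
  filter_upwards [hnear] with v hv
  have hv0 : 0 < v := by linarith [hv.1]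
  exact tvDistance_gaussianReal_le _ _ (by simpa using hv0) (by simpa using hv₀)

end TotalVariation

/-! ### Observables as vectors and the score as a function of one observation. -/

/-- The vector `(y, d, z)` of the observables of one observation. -/
def obsVec {p : ℕ} (x : ℝ × ℝ × (Fin p → ℝ)) : Option (Option (Fin p)) → ℝ :=
  fun k => k.elim x.1 fun l => l.elim x.2.1 x.2.2

lemma measurable_obsVec {p : ℕ} (k : Option (Option (Fin p))) :
    Measurable fun x : ℝ × ℝ × (Fin p → ℝ) => obsVec x k := by
  rcases k with _ | _ | j
  · exact measurable_fst
  · exact measurable_snd.fst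
  · exact (measurable_pi_apply j).comp measurable_snd.snd

/-- The structural error as a linear functional of the observables. -/
def errCoef {p : ℕ} (b : ℝ) (a : Fin p → ℝ) : Option (Option (Fin p)) → ℝ :=
  fun k => k.elim 1 fun l => l.elim (-b) fun j => -a j

lemma obsVec_dotProduct_errCoef {p : ℕ} (x : ℝ × ℝ × (Fin p → ℝ)) (b : ℝ) (a : Fin p → ℝ) :
    obsVec x ⬝ᵥ errCoef b a = x.1 - b * x.2.1 - x.2.2 ⬝ᵥ a := by
  simp only [dotProduct, obsVec, errCoef, Fintype.sum_option, Option.elim_none, Option.elim_some,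
    mul_neg, Finset.sum_neg_distrib]
  ring

lemma measurable_dotProduct {p : ℕ} (c : Fin p → ℝ) : Measurable fun v : Fin p → ℝ => c ⬝ᵥ v := by
  unfold dotProduct
  fun_prop

lemma structErr_eq_dotProduct {Ω : Type*} {p : ℕ} (y d : ℕ → Ω → ℝ) (z : ℕ → Ω → Fin p → ℝ) (β : ℝ)
    (α : Fin p → ℝ) (i : ℕ) (w : Ω) :
    structErr y d z β α i w = obsVec (y i w, d i w, z i w) ⬝ᵥ errCoef β α := by
  rw [obsVec_dotProduct_errCoef, structErr]

/-- The score `(cᵀ z) ε` as a function of one observation. -/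
lemma measurable_scoreFun {p : ℕ} (β : ℝ) (α c : Fin p → ℝ) : Measurable fun x : ℝ × ℝ × (Fin p → ℝ) =>
    (c ⬝ᵥ x.2.2) * (x.1 - β * x.2.1 - x.2.2 ⬝ᵥ α) := by
  have h1 := (measurable_dotProduct c).comp
    (measurable_snd.snd : Measurable fun x : ℝ × ℝ × (Fin p → ℝ) => x.2.2)
  have h2 := (measurable_dotProduct α).comp
    (measurable_snd.snd : Measurable fun x : ℝ × ℝ × (Fin p → ℝ) => x.2.2)
  refine h1.mul ((measurable_fst.sub (measurable_snd.fst.const_mul β)).sub ?_)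
  simpa only [dotProduct_comm, Function.comp_def] using h2

/-! ### Laws of large numbers and second moment bounds. -/

section IID

variable {Ω : Type*} [MeasurableSpace Ω] {μ : Measure Ω} [IsProbabilityMeasure μ]

/-- The weak law of large numbers along `probFilter`. -/
lemma tendsto_mean_probFilter {X : ℕ → Ω → ℝ} (hX : ∀ i, Measurable (X i))
    (hint : Integrable (X 0) μ) (hindep : iIndepFun X μ)
    (hident : ∀ i, IdentDistrib (X i) (X 0) μ μ) :
    Tendsto (fun x : ℕ × Ω => (x.1 : ℝ)⁻¹ * ∑ i : Fin x.1, X i x.2) (probFilter μ)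
      (𝓝 (∫ w, X 0 w ∂μ)) := by
  rw [← tendstoInMeasure_const_iff (f := fun n w => (n : ℝ)⁻¹ * ∑ i : Fin n, X i w)]
  refine tendstoInMeasure_of_tendsto_ae (fun n => ?_) ?_
  · exact ((Finset.measurable_sum Finset.univ fun (i : Fin n) _ => hX i).const_mul
      ((n : ℝ)⁻¹)).aestronglyMeasurable
  · filter_upwards [strong_law_ae_real X hint (fun i j hij => hindep.indepFun hij) hident] with w hw
    refine hw.congr fun n => ?_
    rw [Finset.sum_range, div_eq_inv_mul]

/-- The scaled sum of centred i.i.d. variables is bounded in `L²`. -/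
lemma lintegral_sq_scaled_sum_le {X : ℕ → Ω → ℝ} (hL : MemLp (X 0) 2 μ)
    (hmean : ∫ w, X 0 w ∂μ = 0) (hindep : iIndepFun X μ)
    (hident : ∀ i, IdentDistrib (X i) (X 0) μ μ) (n : ℕ) :
    ∫⁻ w, ENNReal.ofReal (((√n)⁻¹ * ∑ i : Fin n, X i w) ^ 2) ∂μ ≤
      ENNReal.ofReal (Var[X 0; μ]) := by
  have hL' : ∀ i, MemLp (X i) 2 μ := fun i => (hident i).memLp_iff.2 hL
  have hsum : MemLp (∑ i ∈ Finset.range n, X i) 2 μ := memLp_finsetSum' _ fun i _ => hL' i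
  have hvar : Var[∑ i ∈ Finset.range n, X i; μ] = n * Var[X 0; μ] := by
    rw [IndepFun.variance_sum (fun i _ => hL' i) fun i _ j _ hij => hindep.indepFun hij]
    simp [fun i => (hident i).variance_eq]
  have hzero : ∫ w, (∑ i ∈ Finset.range n, X i) w ∂μ = 0 := by
    simp only [Finset.sum_apply]
    rw [integral_finsetSum _ fun i _ => (hL' i).integrable (by norm_num)]
    simp [fun i => (hident i).integral_eq, hmean]
  have hsq : ∫ w, ((∑ i ∈ Finset.range n, X i) w) ^ 2 ∂μ = n * Var[X 0; μ] := by
    rw [← hvar, variance_of_integral_eq_zero hsum.aestronglyMeasurable.aemeasurable hzero]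
  have hform : ∀ w, ((√n)⁻¹ * ∑ i : Fin n, X i w) ^ 2 =
      (n : ℝ)⁻¹ * ((∑ i ∈ Finset.range n, X i) w) ^ 2 := by
    intro w
    rw [Finset.sum_apply, Finset.sum_range, mul_pow, inv_pow, Real.sq_sqrt (Nat.cast_nonneg n)]
  simp_rw [hform]
  rw [← ofReal_integral_eq_lintegral_ofReal (hsum.integrable_sq.const_mul _)
    (ae_of_all _ fun w => by positivity), integral_const_mul, hsq]
  refine ENNReal.ofReal_le_ofReal ?_
  rcases Nat.eq_zero_or_pos n with rfl | hn
  · simp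
  · have : (n : ℝ) ≠ 0 := Nat.cast_ne_zero.2 hn.ne'
    rw [inv_mul_cancel_left₀ this]

end IID

/-! ### Moments and limit theorems for the scores; population moments. -/

namespace IVModel

variable {Ω : Type*} [MeasurableSpace Ω] {μ : Measure Ω}
  {p : ℕ} {y d : ℕ → Ω → ℝ} {z : ℕ → Ω → Fin p → ℝ} {β : ℝ} {α : Fin p → ℝ} {σsq : ℝ}

/-- The second moment matrix of the observables `(Y, D, Z)`. -/
def popObs (μ : Measure Ω) (y d : ℕ → Ω → ℝ) (z : ℕ → Ω → Fin p → ℝ) :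
    Matrix (Option (Option (Fin p))) (Option (Option (Fin p))) ℝ :=
  Matrix.of fun k l => ∫ w, obsVec (y 0 w, d 0 w, z 0 w) k * obsVec (y 0 w, d 0 w, z 0 w) l ∂μ

variable (h : IVModel μ y d z β α σsq)
include h

lemma measurable_obs (i : ℕ) : Measurable fun w => (y i w, d i w, z i w) :=
  (h.measurable_y i).prodMk ((h.measurable_d i).prodMk (h.measurable_z i))

lemma memLp_obsVec (k : Option (Option (Fin p))) :
    MemLp (fun w => obsVec (y 0 w, d 0 w, z 0 w) k) 2 μ := by
  rcases k with _ | _ | j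
  · exact h.memLp_y
  · exact h.memLp_d
  · exact h.memLp_z j

lemma measurable_structErr (i : ℕ) : Measurable (structErr y d z β α i) := by
  have : Measurable fun w => z i w ⬝ᵥ α :=
    Finset.measurable_sum _ fun j _ => ((measurable_pi_apply j).comp (h.measurable_z i)).mul_const _
  exact ((h.measurable_y i).sub ((h.measurable_d i).const_mul β)).sub this

lemma memLp_structErr : MemLp (structErr y d z β α 0) 2 μ := by
  have h1 : MemLp (fun w => ∑ j, z 0 w j * α j) 2 μ :=
    memLp_finsetSum _ fun j _ => (h.memLp_z j).mul_const (α j)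
  exact (h.memLp_y.sub (h.memLp_d.const_mul β)).sub h1

/-- Sample means of functions of one observation converge in probability. -/
lemma tendsto_mean [IsProbabilityMeasure μ] {φ : ℝ × ℝ × (Fin p → ℝ) → ℝ}
    (hφ : Measurable φ)
    (hint : Integrable (fun w => φ (y 0 w, d 0 w, z 0 w)) μ) :
    Tendsto (fun x : ℕ × Ω => (x.1 : ℝ)⁻¹ * ∑ i : Fin x.1, φ (y i x.2, d i x.2, z i x.2))
      (probFilter μ) (𝓝 (∫ w, φ (y 0 w, d 0 w, z 0 w) ∂μ)) :=
  tendsto_mean_probFilter (X := fun i w => φ (y i w, d i w, z i w))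
    (fun i => hφ.comp (h.measurable_obs i)) hint (h.indep.comp (fun _ => φ) fun _ => hφ)
    fun i => (h.ident i).comp hφ

/-- The second moments of the error given the instruments. -/
lemma lintegral_mul_structErr_sq [IsProbabilityMeasure μ] {g : (Fin p → ℝ) → ENNReal} (hg : Measurable g) :
    ∫⁻ w, g (z 0 w) * ENNReal.ofReal (structErr y d z β α 0 w ^ 2) ∂μ =
      ENNReal.ofReal σsq * ∫⁻ w, g (z 0 w) ∂μ := by
  have hm : Measurable fun w => ENNReal.ofReal (structErr y d z β α 0 w ^ 2) :=
    ((h.measurable_structErr 0).pow_const 2).ennreal_ofReal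
  -- Homoscedasticity as an equality of measures on the instrument space. It allows every
  -- nonnegative measurable `g`, with no integrability known in advance.
  have hmeas : (μ.withDensity fun w => ENNReal.ofReal (structErr y d z β α 0 w ^ 2)).map (z 0) =
      ENNReal.ofReal σsq • μ.map (z 0) := by
    ext B hB
    have hzB : MeasurableSet (z 0 ⁻¹' B) := h.measurable_z 0 hB
    rw [Measure.map_apply (h.measurable_z 0) hB, withDensity_apply _ hzB, Measure.smul_apply,
      Measure.map_apply (h.measurable_z 0) hB, smul_eq_mul,
      ← ofReal_integral_eq_lintegral_ofReal h.memLp_structErr.integrable_sq.integrableOn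
        (ae_of_all _ fun _ => sq_nonneg _),
      ← setIntegral_condExp (h.measurable_z 0).comap_le h.memLp_structErr.integrable_sq
        ⟨B, hB, rfl⟩,
      setIntegral_congr_ae hzB ((h.err_var 0).mono fun w hw _ => hw), setIntegral_const, smul_eq_mul,
      mul_comm, ENNReal.ofReal_mul h.sigma_pos.le, Measure.real,
      ENNReal.ofReal_toReal (measure_ne_top _ _)]
  have h1 : ∫⁻ w, g (z 0 w) * ENNReal.ofReal (structErr y d z β α 0 w ^ 2) ∂μ =
      ∫⁻ w, g (z 0 w) ∂(μ.withDensity fun w => ENNReal.ofReal (structErr y d z β α 0 w ^ 2)) := by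
    have hgz : Measurable fun w => g (z 0 w) := hg.comp (h.measurable_z 0)
    rw [lintegral_withDensity_eq_lintegral_mul _ hm hgz]
    exact lintegral_congr fun w => mul_comm _ _
  rw [h1, ← lintegral_map hg (h.measurable_z 0), hmeas, lintegral_smul_measure,
    lintegral_map hg (h.measurable_z 0), smul_eq_mul]

lemma memLp_dotProduct (c : Fin p → ℝ) : MemLp (fun w => c ⬝ᵥ z 0 w) 2 μ :=
  memLp_finsetSum _ fun j _ => (h.memLp_z j).const_mul (c j)

lemma integral_dotProduct_sq (c : Fin p → ℝ) :
    ∫ w, (c ⬝ᵥ z 0 w) ^ 2 ∂μ = c ⬝ᵥ (popZZ μ z *ᵥ c) := by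
  have hi : ∀ j k, Integrable (fun w => z 0 w j * z 0 w k) μ := fun j k =>
    (h.memLp_z j).integrable_mul (h.memLp_z k)
  have h1 : ∀ w, (c ⬝ᵥ z 0 w) ^ 2 = ∑ j, ∑ k, c j * c k * (z 0 w j * z 0 w k) := by
    intro w
    rw [dotProduct, sq, Finset.sum_mul_sum]
    exact Finset.sum_congr rfl fun j _ => Finset.sum_congr rfl fun k _ => by ring
  simp_rw [h1]
  rw [integral_finsetSum _ fun j _ => integrable_finsetSum _ fun k _ => (hi j k).const_mul _]
  simp only [dotProduct, Matrix.mulVec, popZZ, Finset.mul_sum]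
  refine Finset.sum_congr rfl fun j _ => ?_
  rw [integral_finsetSum _ fun k _ => (hi j k).const_mul _]
  refine Finset.sum_congr rfl fun k _ => ?_
  rw [integral_const_mul]
  ring

/-- With only second moments assumed, square integrability of a product is not automatic. Here the
constant conditional variance gives E(cᵀz)²ε² = σ² E(cᵀz)² < ∞. -/
lemma memLp_score [IsProbabilityMeasure μ] (c : Fin p → ℝ) :
    MemLp (fun w => (c ⬝ᵥ z 0 w) * structErr y d z β α 0 w) 2 μ := by
  have hm : Measurable fun w => (c ⬝ᵥ z 0 w) * structErr y d z β α 0 w :=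
    ((measurable_dotProduct c).comp (h.measurable_z 0)).mul (h.measurable_structErr 0)
  refine (memLp_two_iff_integrable_sq hm.aestronglyMeasurable).2
    ⟨(hm.pow_const 2).aestronglyMeasurable, ?_⟩
  rw [hasFiniteIntegral_iff_ofReal (ae_of_all _ fun _ => sq_nonneg _)]
  have h1 : ∀ w, ENNReal.ofReal (((c ⬝ᵥ z 0 w) * structErr y d z β α 0 w) ^ 2) =
      ENNReal.ofReal ((c ⬝ᵥ z 0 w) ^ 2) * ENNReal.ofReal (structErr y d z β α 0 w ^ 2) := by
    intro w
    rw [mul_pow, ENNReal.ofReal_mul (sq_nonneg _)]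
  simp_rw [h1]
  rw [h.lintegral_mul_structErr_sq (g := fun v => ENNReal.ofReal ((c ⬝ᵥ v) ^ 2))
    ((measurable_dotProduct c).pow_const 2).ennreal_ofReal]
  refine ENNReal.mul_lt_top ENNReal.ofReal_lt_top ?_
  exact (hasFiniteIntegral_iff_ofReal (ae_of_all _ fun _ => sq_nonneg _)).1
    (h.memLp_dotProduct c).integrable_sq.2

/-- The factor cᵀz is measurable with respect to the instruments and pulls out of the conditional
expectation, leaving E(ε | z) = 0. -/
lemma integral_score [IsProbabilityMeasure μ] (c : Fin p → ℝ) :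
    ∫ w, (c ⬝ᵥ z 0 w) * structErr y d z β α 0 w ∂μ = 0 := by
  have hle := (h.measurable_z 0).comap_le
  have hpull := condExp_mul_of_stronglyMeasurable_left (μ := μ)
    (m := MeasurableSpace.comap (z 0) inferInstance) (f := fun w => c ⬝ᵥ z 0 w)
    (g := structErr y d z β α 0)
    (((measurable_dotProduct c).comp (comap_measurable (z 0))).stronglyMeasurable)
    ((h.memLp_score c).integrable (by norm_num)) (h.memLp_structErr.integrable (by norm_num))
  have := integral_condExp (μ := μ) (f := (fun w => c ⬝ᵥ z 0 w) * structErr y d z β α 0) hle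
  rw [integral_congr_ae hpull] at this
  refine this.symm.trans ?_
  refine (integral_congr_ae (g := fun _ => (0 : ℝ)) ?_).trans (integral_zero _ _)
  filter_upwards [h.err_mean 0] with w hw
  simp [hw]

lemma variance_score [IsProbabilityMeasure μ] (c : Fin p → ℝ) :
    Var[fun w => (c ⬝ᵥ z 0 w) * structErr y d z β α 0 w; μ] =
      σsq * (c ⬝ᵥ (popZZ μ z *ᵥ c)) := by
  have hm : Measurable fun w => (c ⬝ᵥ z 0 w) * structErr y d z β α 0 w :=
    ((measurable_dotProduct c).comp (h.measurable_z 0)).mul (h.measurable_structErr 0)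
  rw [variance_of_integral_eq_zero hm.aemeasurable (h.integral_score c),
    ← h.integral_dotProduct_sq c]
  rw [integral_eq_lintegral_of_nonneg_ae (ae_of_all _ fun _ => sq_nonneg _)
    (hm.pow_const 2).aestronglyMeasurable,
    integral_eq_lintegral_of_nonneg_ae (ae_of_all _ fun _ => sq_nonneg _)
    (h.memLp_dotProduct c).integrable_sq.aestronglyMeasurable]
  have h1 : ∀ w, ENNReal.ofReal (((c ⬝ᵥ z 0 w) * structErr y d z β α 0 w) ^ 2) =
      ENNReal.ofReal ((c ⬝ᵥ z 0 w) ^ 2) * ENNReal.ofReal (structErr y d z β α 0 w ^ 2) := by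
    intro w
    rw [mul_pow, ENNReal.ofReal_mul (sq_nonneg _)]
  simp_rw [h1]
  rw [h.lintegral_mul_structErr_sq (g := fun v => ENNReal.ofReal ((c ⬝ᵥ v) ^ 2))
    ((measurable_dotProduct c).pow_const 2).ennreal_ofReal, ENNReal.toReal_mul,
    ENNReal.toReal_ofReal h.sigma_pos.le]

lemma measurable_score (c : Fin p → ℝ) (i : ℕ) :
    Measurable fun w => (c ⬝ᵥ z i w) * structErr y d z β α i w :=
  ((measurable_dotProduct c).comp (h.measurable_z i)).mul (h.measurable_structErr i)

lemma iIndepFun_score (c : Fin p → ℝ) :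
    iIndepFun (fun i w => (c ⬝ᵥ z i w) * structErr y d z β α i w) μ :=
  h.indep.comp (fun _ x => (c ⬝ᵥ x.2.2) * (x.1 - β * x.2.1 - x.2.2 ⬝ᵥ α))
    fun _ => measurable_scoreFun β α c

lemma identDistrib_score (c : Fin p → ℝ) (i : ℕ) :
    IdentDistrib (fun w => (c ⬝ᵥ z i w) * structErr y d z β α i w)
      (fun w => (c ⬝ᵥ z 0 w) * structErr y d z β α 0 w) μ μ :=
  (h.ident i).comp (measurable_scoreFun β α c)

/-- The central limit theorem for the scores. -/
lemma tendstoInDistribution_score [IsProbabilityMeasure μ] (c : Fin p → ℝ) :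
    TendstoInDistribution
      (fun (n : ℕ) w => (√n)⁻¹ * ∑ i : Fin n, (c ⬝ᵥ z i w) * structErr y d z β α i w) atTop
      (id : ℝ → ℝ) (fun _ => μ)
      (gaussianReal 0 (σsq * (c ⬝ᵥ (popZZ μ z *ᵥ c))).toNNReal) := by
  have hlaw : HasLaw (id : ℝ → ℝ)
      (gaussianReal 0 Var[fun w => (c ⬝ᵥ z 0 w) * structErr y d z β α 0 w; μ].toNNReal)
      (gaussianReal 0 (σsq * (c ⬝ᵥ (popZZ μ z *ᵥ c))).toNNReal) :=
    ⟨aemeasurable_id, by rw [Measure.map_id, h.variance_score c]⟩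
  have := tendstoInDistribution_inv_sqrt_mul_sum_sub
    (X := fun i w => (c ⬝ᵥ z i w) * structErr y d z β α i w) hlaw (h.memLp_score c) (h.iIndepFun_score c)
    (h.identDistrib_score c)
  simpa only [h.integral_score c, mul_zero, sub_zero, Finset.sum_range] using this

/-- Vanishing coefficients times scaled score sums vanish in probability. -/
lemma tendsto_mul_score [IsProbabilityMeasure μ] {a : ℕ → Ω → ℝ} (c : Fin p → ℝ)
    (ha : Tendsto (fun x : ℕ × Ω => a x.1 x.2) (probFilter μ) (𝓝 0)) :
    Tendsto (fun x : ℕ × Ω => a x.1 x.2 *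
      ((√x.1)⁻¹ * ∑ i : Fin x.1, (c ⬝ᵥ z i x.2) * structErr y d z β α i x.2))
      (probFilter μ) (𝓝 0) :=
  tendsto_mul_probFilter_of_bounded_sq
    (U := fun n w => (√n)⁻¹ * ∑ i : Fin n, (c ⬝ᵥ z i w) * structErr y d z β α i w)
    ENNReal.ofReal_ne_top
    (fun n => ((Finset.measurable_fun_sum Finset.univ fun (i : Fin n) _ =>
      h.measurable_score c i).const_mul _).aemeasurable)
    (lintegral_sq_scaled_sum_le
      (X := fun i w => (c ⬝ᵥ z i w) * structErr y d z β α i w) (h.memLp_score c)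
      (h.integral_score c) (h.iIndepFun_score c) (h.identDistrib_score c)) ha

lemma popZZ_posSemidef : (popZZ μ z).PosSemidef := by
  refine Matrix.PosSemidef.of_dotProduct_mulVec_nonneg ?_ fun x => ?_
  · ext j k
    simp [popZZ, mul_comm]
  · rw [star_trivial, ← h.integral_dotProduct_sq]
    exact integral_nonneg fun _ => sq_nonneg _

lemma popZZ_posDef : (popZZ μ z).PosDef :=
  h.popZZ_posSemidef.posDef_iff_det_ne_zero.2 h.nonsing

lemma dotProduct_popObs_mulVec (v : Option (Option (Fin p)) → ℝ) :
    v ⬝ᵥ (popObs μ y d z *ᵥ v) = ∫ w, (obsVec (y 0 w, d 0 w, z 0 w) ⬝ᵥ v) ^ 2 ∂μ := by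
  have hi : ∀ j k, Integrable (fun w => obsVec (y 0 w, d 0 w, z 0 w) j *
      obsVec (y 0 w, d 0 w, z 0 w) k) μ := fun j k =>
    (h.memLp_obsVec j).integrable_mul (h.memLp_obsVec k)
  have h1 : ∀ w, (obsVec (y 0 w, d 0 w, z 0 w) ⬝ᵥ v) ^ 2 = ∑ j, ∑ k, v j * v k *
      (obsVec (y 0 w, d 0 w, z 0 w) j * obsVec (y 0 w, d 0 w, z 0 w) k) := by
    intro w
    rw [dotProduct, sq, Finset.sum_mul_sum]
    exact Finset.sum_congr rfl fun j _ => Finset.sum_congr rfl fun k _ => by ring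
  simp_rw [h1]
  rw [integral_finsetSum _ fun j _ => integrable_finsetSum _ fun k _ => (hi j k).const_mul _]
  simp only [dotProduct, Matrix.mulVec, popObs, Matrix.of_apply, Finset.mul_sum]
  refine Finset.sum_congr rfl fun j _ => ?_
  rw [integral_finsetSum _ fun k _ => (hi j k).const_mul _]
  refine Finset.sum_congr rfl fun k _ => ?_
  rw [integral_const_mul]
  ring

lemma popObs_posSemidef : (popObs μ y d z).PosSemidef := by
  refine Matrix.PosSemidef.of_dotProduct_mulVec_nonneg ?_ fun x => ?_
  · ext j k
    simp [popObs, mul_comm]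
  · rw [star_trivial, h.dotProduct_popObs_mulVec]
    exact integral_nonneg fun _ => sq_nonneg _

lemma integral_structErr_sq [IsProbabilityMeasure μ] : ∫ w, structErr y d z β α 0 w ^ 2 ∂μ = σsq := by
  rw [← integral_condExp (h.measurable_z 0).comap_le, integral_congr_ae (h.err_var 0)]
  simp

/-- The population moments `E(Z Y)` in terms of the structural parameters. -/
lemma popObs_some_none [IsProbabilityMeasure μ] (j : Fin p) :
    popObs μ y d z (some (some j)) none = β * popZD μ d z j + (popZZ μ z *ᵥ α) j := by
  have hi : ∀ k, Integrable (fun w => z 0 w j * z 0 w k) μ := fun k =>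
    (h.memLp_z j).integrable_mul (h.memLp_z k)
  have h1 : ∫ w, z 0 w j * structErr y d z β α 0 w ∂μ = 0 := by
    simpa using h.integral_score (Pi.single j 1)
  have h2 : ∀ w, z 0 w j * y 0 w = z 0 w j * structErr y d z β α 0 w +
      (β * (z 0 w j * d 0 w) + ∑ k, z 0 w j * z 0 w k * α k) := by
    intro w
    simp only [structErr, dotProduct, mul_assoc, ← Finset.mul_sum]
    ring
  change ∫ w, z 0 w j * y 0 w ∂μ = _
  simp_rw [h2]
  have i1 : Integrable (fun w => z 0 w j * structErr y d z β α 0 w) μ :=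
    (h.memLp_z j).integrable_mul h.memLp_structErr
  have i2 : Integrable (fun w => β * (z 0 w j * d 0 w)) μ :=
    ((h.memLp_z j).integrable_mul h.memLp_d).const_mul β
  have i3 : Integrable (fun w => ∑ k, z 0 w j * z 0 w k * α k) μ :=
    integrable_finsetSum _ fun k _ => (hi k).mul_const _
  have i23 : Integrable (fun w => β * (z 0 w j * d 0 w) + ∑ k, z 0 w j * z 0 w k * α k) μ :=
    i2.add i3
  rw [integral_add i1 i23, h1, zero_add, integral_add i2 i3, integral_const_mul,
    integral_finsetSum _ fun k _ => (hi k).mul_const _]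
  simp only [integral_mul_const]
  rfl

end IVModel

lemma eventually_fst_ne_zero {Ω : Type*} [MeasurableSpace Ω] {μ : Measure Ω} :
    ∀ᶠ x : ℕ × Ω in probFilter μ, x.1 ≠ 0 :=
  tendsto_fst_probFilter.eventually (eventually_ne_atTop 0)

/-! ### Continuity of the matrix operations along a filter. -/

section MatrixLimits

variable {ι l m n : Type*} {L : Filter ι}

lemma Filter.Tendsto.matrixMul [Fintype m] {f : ι → Matrix n m ℝ} {g : ι → Matrix m l ℝ} {A : Matrix n m ℝ}
    {B : Matrix m l ℝ} (hf : Tendsto f L (𝓝 A)) (hg : Tendsto g L (𝓝 B)) :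
    Tendsto (fun x => f x * g x) L (𝓝 (A * B)) :=
  ((Continuous.matrix_mul continuous_fst continuous_snd).tendsto (A, B)).comp (hf.prodMk_nhds hg)

lemma Filter.Tendsto.matrixMulVec [Fintype m] {f : ι → Matrix n m ℝ} {g : ι → m → ℝ} {A : Matrix n m ℝ}
    {v : m → ℝ} (hf : Tendsto f L (𝓝 A)) (hg : Tendsto g L (𝓝 v)) :
    Tendsto (fun x => f x *ᵥ g x) L (𝓝 (A *ᵥ v)) :=
  ((Continuous.matrix_mulVec continuous_fst continuous_snd).tendsto (A, v)).comp
    (hf.prodMk_nhds hg)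

lemma Filter.Tendsto.dotProduct' [Fintype m] {f g : ι → m → ℝ} {u v : m → ℝ} (hf : Tendsto f L (𝓝 u))
    (hg : Tendsto g L (𝓝 v)) : Tendsto (fun x => f x ⬝ᵥ g x) L (𝓝 (u ⬝ᵥ v)) :=
  ((Continuous.dotProduct continuous_fst continuous_snd).tendsto (u, v)).comp (hf.prodMk_nhds hg)

lemma Filter.Tendsto.matrixTranspose {f : ι → Matrix n m ℝ} {A : Matrix n m ℝ}
    (hf : Tendsto f L (𝓝 A)) : Tendsto (fun x => (f x)ᵀ) L (𝓝 Aᵀ) :=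
  ((Continuous.matrix_transpose continuous_id).tendsto A).comp hf

lemma Filter.Tendsto.matrixDet [Fintype m] [DecidableEq m] {f : ι → Matrix m m ℝ} {A : Matrix m m ℝ}
    (hf : Tendsto f L (𝓝 A)) : Tendsto (fun x => (f x).det) L (𝓝 A.det) :=
  ((Continuous.matrix_det continuous_id).tendsto A).comp hf

lemma Filter.Tendsto.matrixInv [Fintype m] [DecidableEq m] {f : ι → Matrix m m ℝ} {A : Matrix m m ℝ}
    (hf : Tendsto f L (𝓝 A)) (hA : A.det ≠ 0) : Tendsto (fun x => (f x)⁻¹) L (𝓝 A⁻¹) := by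
  refine (continuousAt_matrix_inv A ?_).tendsto.comp hf
  have : (Ring.inverse : ℝ → ℝ) = fun x => x⁻¹ := by ext x; simp
  rw [this]
  exact continuousAt_inv₀ hA

lemma tendsto_matrix_iff {f : ι → Matrix n l ℝ} {A : Matrix n l ℝ} :
    Tendsto f L (𝓝 A) ↔ ∀ i j, Tendsto (fun x => f x i j) L (𝓝 (A i j)) := by
  rw [show Tendsto f L (𝓝 A) ↔ ∀ i, Tendsto (fun x => f x i) L (𝓝 (A i)) from tendsto_pi_nhds]
  exact forall_congr' fun i => tendsto_pi_nhds

end MatrixLimits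

/-- Two sets with fewer than p/2 elements cannot cover p points. This is how the majority condition
enters identification. -/
lemma exists_notMem_of_mem_modelSpace {p : ℕ} {ω ω' : Finset (Fin p)} (hω : ω ∈ modelSpace p)
    (hω' : (ω'.card : ℝ) < (p : ℝ) / 2) : ∃ j, j ∉ ω ∧ j ∉ ω' := by
  by_contra! hall
  have h1 : (ω.card : ℝ) < (p : ℝ) / 2 := (Finset.mem_filter.1 hω).2
  have h2 : (Finset.univ : Finset (Fin p)) ⊆ ω ∪ ω' := fun j _ => by
    by_cases hj : j ∈ ω
    · exact Finset.mem_union_left _ hj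
    · exact Finset.mem_union_right _ (hall j hj)
  have h3 := (Finset.card_le_card h2).trans (Finset.card_union_le _ _)
  rw [Finset.card_univ, Fintype.card_fin] at h3
  have h4 : (p : ℝ) ≤ ω.card + ω'.card := by exact_mod_cast h3
  linarith

/-- The moments generated by a structural parameter whose support lies in `ω`. -/
lemma smul_add_mulVec_eq_crossMat_mulVec {p : ℕ} (S : Matrix (Fin p) (Fin p) ℝ) (s : Fin p → ℝ)
    (β : ℝ) {α : Fin p → ℝ} {ω : Finset (Fin p)} (hsub : invalidSet α ⊆ ω) :
    β • s + S *ᵥ α = crossMat S s ω *ᵥ fun k : Option ω => k.elim β fun j => α j := by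
  have hext : extendZero ω (fun k : Option ω => k.elim β fun j => α j) = α := by
    ext j
    by_cases hj : j ∈ ω
    · simp [extendZero, hj]
    · have : α j = 0 := by
        by_contra hne
        exact hj (hsub (by simpa [invalidSet] using hne))
      simp [extendZero, hj, this]
  rw [crossMat, optionElim_mulVec, hext, Option.elim_none]

/-! ### Sample moments of the observables. -/

namespace IVData

variable {n p : ℕ} (D : IVData n p)

/-- The sample second moment matrix of the observables. -/
def obsMat : Matrix (Option (Option (Fin p))) (Option (Option (Fin p))) ℝ :=
  Matrix.of fun k l => (n : ℝ)⁻¹ *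
    ∑ i, obsVec (D.y i, D.d i, D.Z i) k * obsVec (D.y i, D.d i, D.Z i) l

lemma momZZ_apply (j k : Fin p) : D.momZZ j k = D.obsMat (some (some j)) (some (some k)) := by
  simp [momZZ, obsMat, obsVec, Matrix.mul_apply]

lemma mom_d_apply (j : Fin p) : D.mom D.d j = D.obsMat (some (some j)) (some none) := by
  simp [mom, obsMat, obsVec, Matrix.mulVec, dotProduct]

lemma mom_y_apply (j : Fin p) : D.mom D.y j = D.obsMat (some (some j)) none := by
  simp [mom, obsMat, obsVec, Matrix.mulVec, dotProduct]

/-- Writes the residual variance as a continuous function of the estimator and the sample second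
moments, so that its limit follows from theirs. -/
lemma sigmaHatSq_eq (ω : Finset (Fin p)) : D.sigmaHatSq ω =
    errCoef (D.thetaHat ω none) (extendZero ω (D.thetaHat ω)) ⬝ᵥ
      (D.obsMat *ᵥ errCoef (D.thetaHat ω none) (extendZero ω (D.thetaHat ω))) := by
  set v := errCoef (D.thetaHat ω none) (extendZero ω (D.thetaHat ω)) with hv
  have h1 : ∀ i, D.y i - D.yHat ω i = obsVec (D.y i, D.d i, D.Z i) ⬝ᵥ v := by
    intro i
    rw [hv, obsVec_dotProduct_errCoef, yHat, R_mulVec]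
    simp only [Pi.add_apply, Pi.smul_apply, smul_eq_mul, Matrix.mulVec]
    ring
  have h2 : ∀ i, (obsVec (D.y i, D.d i, D.Z i) ⬝ᵥ v) ^ 2 = ∑ k, ∑ l, v k * v l *
      (obsVec (D.y i, D.d i, D.Z i) k * obsVec (D.y i, D.d i, D.Z i) l) := by
    intro i
    rw [dotProduct, sq, Finset.sum_mul_sum]
    exact Finset.sum_congr rfl fun j _ => Finset.sum_congr rfl fun k _ => by ring
  rw [sigmaHatSq]
  simp_rw [h1, h2]
  simp only [dotProduct, Matrix.mulVec, obsMat, Matrix.of_apply, Finset.mul_sum, Finset.sum_mul]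
  rw [Finset.sum_comm]
  refine Finset.sum_congr rfl fun k _ => ?_
  rw [Finset.sum_comm]
  refine Finset.sum_congr rfl fun l _ => Finset.sum_congr rfl fun i _ => ?_
  ring

end IVData

/-! ### Identification and probability limits. -/

namespace IVModel

section Population

variable {Ω : Type*} [MeasurableSpace Ω]

/-- The population counterpart of `IVData.gram`. -/
def popGram {p : ℕ} (μ : Measure Ω) (d : ℕ → Ω → ℝ) (z : ℕ → Ω → Fin p → ℝ)
    (ω : Finset (Fin p)) : Matrix (Option ω) (Option ω) ℝ :=
  gramMat (popZZ μ z) (popZD μ d z) ω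

/-- The probability limit of the two-stage least squares estimator in the model `ω`. -/
def popTheta {p : ℕ} (μ : Measure Ω) (d : ℕ → Ω → ℝ) (z : ℕ → Ω → Fin p → ℝ) (β : ℝ)
    (α : Fin p → ℝ) (ω : Finset (Fin p)) : Option ω → ℝ :=
  (popGram μ d z ω)⁻¹ *ᵥ (((crossMat (popZZ μ z) (popZD μ d z) ω)ᵀ * (popZZ μ z)⁻¹) *ᵥ
    (β • popZD μ d z + popZZ μ z *ᵥ α))

/-- The probability limit of the variance estimator in the model `ω`. -/
def popSigmaSq {p : ℕ} (μ : Measure Ω) (y d : ℕ → Ω → ℝ) (z : ℕ → Ω → Fin p → ℝ) (β : ℝ)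
    (α : Fin p → ℝ) (ω : Finset (Fin p)) : ℝ :=
  errCoef (popTheta μ d z β α ω none) (extendZero ω (popTheta μ d z β α ω)) ⬝ᵥ
    (popObs μ y d z *ᵥ
      errCoef (popTheta μ d z β α ω none) (extendZero ω (popTheta μ d z β α ω)))

/-- The probability limit of the sample moment of the residuals in the model `ω`. -/
def popResid {p : ℕ} (μ : Measure Ω) (d : ℕ → Ω → ℝ) (z : ℕ → Ω → Fin p → ℝ) (β : ℝ)
    (α : Fin p → ℝ) (ω : Finset (Fin p)) : Fin p → ℝ :=
  β • popZD μ d z + popZZ μ z *ᵥ α -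
    crossMat (popZZ μ z) (popZD μ d z) ω *ᵥ popTheta μ d z β α ω

end Population

variable {Ω : Type*} [MeasurableSpace Ω] {μ : Measure Ω}
  {p : ℕ} {y d : ℕ → Ω → ℝ} {z : ℕ → Ω → Fin p → ℝ} {β : ℝ} {α : Fin p → ℝ} {σsq : ℝ}
  (h : IVModel μ y d z β α σsq) {ω : Finset (Fin p)}
include h

lemma popGram_posDef (hmaj : ((invalidSet α).card : ℝ) < (p : ℝ) / 2) (hω : ω ∈ modelSpace p) :
    (popGram μ d z ω).PosDef := by
  refine gramMat_posDef h.popZZ_posDef ?_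
  obtain ⟨j, hj, hj'⟩ := exists_notMem_of_mem_modelSpace hω hmaj
  exact ⟨j, hj, h.relevant j (by simpa [invalidSet] using hj')⟩

/-- After applying E(ZZᵀ)⁻¹, read the equation at a valid instrument outside `ω`: both direct
effects vanish there and relevance forces the two values of β to agree. The direct effects then
agree as well. -/
lemma popTheta_of_popResid_eq_zero (hmaj : ((invalidSet α).card : ℝ) < (p : ℝ) / 2)
    (hω : ω ∈ modelSpace p) (h0 : popResid μ d z β α ω = 0) :
    popTheta μ d z β α ω none = β ∧ extendZero ω (popTheta μ d z β α ω) = α := by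
  set S := popZZ μ z with hS
  set s := popZD μ d z with hs
  have hu : IsUnit S.det := (Matrix.isUnit_iff_isUnit_det _).1 h.popZZ_posDef.isUnit
  set θ := popTheta μ d z β α ω
  have h1 : (β - θ none) • (S⁻¹ *ᵥ s) + α - extendZero ω θ = 0 := by
    have := congrArg (fun v => S⁻¹ *ᵥ v) h0
    simp only [popResid, crossMat, optionElim_mulVec, Matrix.mulVec_sub, Matrix.mulVec_add,
      Matrix.mulVec_smul, Matrix.mulVec_mulVec, ← hS, ← hs, Matrix.nonsing_inv_mul _ hu,
      Matrix.one_mulVec, Matrix.mulVec_zero] at this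
    rw [← this, sub_smul]
    abel
  obtain ⟨k, hk, hk'⟩ := exists_notMem_of_mem_modelSpace hω hmaj
  have hk0 : α k = 0 := by simpa [invalidSet] using hk'
  have hrel : (S⁻¹ *ᵥ s) k ≠ 0 := h.relevant k hk0
  have h2 : β - θ none = 0 := by
    have := congrFun h1 k
    simpa [extendZero, hk, hk0, hrel] using this
  refine ⟨(sub_eq_zero.1 h2).symm, ?_⟩
  rw [h2, zero_smul, zero_add] at h1
  exact (sub_eq_zero.1 h1).symm

/-- Vanishing residual moments recover α, whose support would then lie in `ω`. Conversely, the true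
parameter is a parameter of the model, so it solves the normal equations with zero residual. -/
lemma popResid_eq_zero_iff (hmaj : ((invalidSet α).card : ℝ) < (p : ℝ) / 2)
    (hω : ω ∈ modelSpace p) : popResid μ d z β α ω = 0 ↔ invalidSet α ⊆ ω := by
  constructor
  · intro h0 j hj
    by_contra hjω
    have hα : α j ≠ 0 := by simpa [invalidSet] using hj
    have h1 := congrFun (h.popTheta_of_popResid_eq_zero hmaj hω h0).2 j
    simp [extendZero, hjω, hα.symm] at h1
  · intro hsub
    set S := popZZ μ z with hS
    set s := popZD μ d z with hs
    have hr : β • s + S *ᵥ α =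
        crossMat S s ω *ᵥ fun k : Option ω => k.elim β fun j => α j :=
      smul_add_mulVec_eq_crossMat_mulVec S s β hsub
    have hG : IsUnit (gramMat S s ω).det :=
      (Matrix.isUnit_iff_isUnit_det _).1 (h.popGram_posDef hmaj hω).isUnit
    rw [popResid, popTheta, ← hS, ← hs, hr, Matrix.mulVec_mulVec _ _ (crossMat S s ω), popGram,
      ← gramMat, Matrix.mulVec_mulVec _ _ (gramMat S s ω), Matrix.nonsing_inv_mul _ hG,
      Matrix.one_mulVec, sub_self]

/-- In a model that contains the invalid instruments the estimand is the structural parameter. -/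
lemma popTheta_of_subset (hmaj : ((invalidSet α).card : ℝ) < (p : ℝ) / 2)
    (hω : ω ∈ modelSpace p) (hsub : invalidSet α ⊆ ω) :
    popTheta μ d z β α ω none = β ∧ extendZero ω (popTheta μ d z β α ω) = α :=
  h.popTheta_of_popResid_eq_zero hmaj hω ((h.popResid_eq_zero_iff hmaj hω).2 hsub)

lemma popObs_mulVec_errCoef [IsProbabilityMeasure μ] (b : ℝ) (a : Fin p → ℝ) (j : Fin p) :
    (popObs μ y d z *ᵥ errCoef b a) (some (some j)) =
      (β • popZD μ d z + popZZ μ z *ᵥ α - (b • popZD μ d z + popZZ μ z *ᵥ a)) j := by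
  have h1 : popObs μ y d z (some (some j)) (some none) = popZD μ d z j := rfl
  have h2 : ∀ k, popObs μ y d z (some (some j)) (some (some k)) = popZZ μ z j k := fun k => rfl
  simp only [Matrix.mulVec, dotProduct, Fintype.sum_option, errCoef, Option.elim_none,
    Option.elim_some, h.popObs_some_none, h1, h2, Pi.sub_apply, Pi.add_apply, Pi.smul_apply,
    smul_eq_mul, mul_neg, Finset.sum_neg_distrib]
  ring

lemma popSigmaSq_of_subset [IsProbabilityMeasure μ]
    (hmaj : ((invalidSet α).card : ℝ) < (p : ℝ) / 2) (hω : ω ∈ modelSpace p)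
    (hsub : invalidSet α ⊆ ω) : popSigmaSq μ y d z β α ω = σsq := by
  obtain ⟨h1, h2⟩ := h.popTheta_of_subset hmaj hω hsub
  rw [popSigmaSq, h1, h2, h.dotProduct_popObs_mulVec, ← h.integral_structErr_sq]
  simp only [structErr_eq_dotProduct]

/-- In a misspecified model, a zero value of the positive semidefinite form would put the
coefficient vector in its kernel. The instrument rows of that kernel equation say that the residual
moments vanish, contradicting `popResid_eq_zero_iff`. -/
lemma popSigmaSq_pos [IsProbabilityMeasure μ] (hmaj : ((invalidSet α).card : ℝ) < (p : ℝ) / 2)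
    (hω : ω ∈ modelSpace p) : 0 < popSigmaSq μ y d z β α ω := by
  by_cases hsub : invalidSet α ⊆ ω
  · rw [h.popSigmaSq_of_subset hmaj hω hsub]
    exact h.sigma_pos
  · have hnonneg := h.popObs_posSemidef.dotProduct_mulVec_nonneg
      (errCoef (popTheta μ d z β α ω none) (extendZero ω (popTheta μ d z β α ω)))
    refine lt_of_le_of_ne hnonneg fun h0 => hsub ?_
    have h1 : popObs μ y d z *ᵥ
        errCoef (popTheta μ d z β α ω none) (extendZero ω (popTheta μ d z β α ω)) = 0 :=
      (h.popObs_posSemidef.dotProduct_mulVec_zero_iff _).1 h0.symm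
    rw [← h.popResid_eq_zero_iff hmaj hω]
    ext j
    rw [popResid, crossMat, optionElim_mulVec, ← h.popObs_mulVec_errCoef, h1]
    rfl

section Limits

variable [IsProbabilityMeasure μ]

lemma tendsto_obsMat : Tendsto (fun x : ℕ × Ω => (ivSample y d z x.1 x.2).obsMat) (probFilter μ)
    (𝓝 (popObs μ y d z)) := by
  refine tendsto_matrix_iff.2 fun k l => ?_
  have hm : Measurable fun x : ℝ × ℝ × (Fin p → ℝ) => obsVec x k * obsVec x l :=
    (measurable_obsVec k).mul (measurable_obsVec l)
  have hi : Integrable (fun w => obsVec (y 0 w, d 0 w, z 0 w) k * obsVec (y 0 w, d 0 w, z 0 w) l)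
      μ := (h.memLp_obsVec k).integrable_mul (h.memLp_obsVec l)
  simpa only [IVData.obsMat, Matrix.of_apply, ivSample, popObs] using
    h.tendsto_mean (φ := fun x => obsVec x k * obsVec x l) hm hi

lemma tendsto_momZZ : Tendsto (fun x : ℕ × Ω => (ivSample y d z x.1 x.2).momZZ) (probFilter μ)
    (𝓝 (popZZ μ z)) := by
  refine tendsto_matrix_iff.2 fun j k => ?_
  simp only [IVData.momZZ_apply]
  exact tendsto_matrix_iff.1 h.tendsto_obsMat (some (some j)) (some (some k))

lemma tendsto_mom_d : Tendsto (fun x : ℕ × Ω => (ivSample y d z x.1 x.2).mom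
    (ivSample y d z x.1 x.2).d) (probFilter μ) (𝓝 (popZD μ d z)) := by
  refine tendsto_pi_nhds.2 fun j => ?_
  simp only [IVData.mom_d_apply]
  exact tendsto_matrix_iff.1 h.tendsto_obsMat (some (some j)) (some none)

lemma tendsto_mom_y : Tendsto (fun x : ℕ × Ω => (ivSample y d z x.1 x.2).mom
    (ivSample y d z x.1 x.2).y) (probFilter μ) (𝓝 (β • popZD μ d z + popZZ μ z *ᵥ α)) := by
  refine tendsto_pi_nhds.2 fun j => ?_
  simp only [IVData.mom_y_apply]
  have := tendsto_matrix_iff.1 h.tendsto_obsMat (some (some j)) none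
  rwa [h.popObs_some_none] at this

lemma tendsto_momZZ_inv : Tendsto (fun x : ℕ × Ω => (ivSample y d z x.1 x.2).momZZ⁻¹)
    (probFilter μ) (𝓝 (popZZ μ z)⁻¹) :=
  h.tendsto_momZZ.matrixInv h.nonsing

lemma tendsto_momZR (ω : Finset (Fin p)) :
    Tendsto (fun x : ℕ × Ω => (ivSample y d z x.1 x.2).momZR ω)
    (probFilter μ) (𝓝 (crossMat (popZZ μ z) (popZD μ d z) ω)) := by
  refine tendsto_matrix_iff.2 fun j k => ?_
  simp only [IVData.momZR_eq]
  rcases k with _ | k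
  · exact tendsto_pi_nhds.1 h.tendsto_mom_d j
  · exact tendsto_matrix_iff.1 h.tendsto_momZZ j k

lemma tendsto_gram (ω : Finset (Fin p)) :
    Tendsto (fun x : ℕ × Ω => (ivSample y d z x.1 x.2).gram ω)
    (probFilter μ) (𝓝 (popGram μ d z ω)) :=
  ((h.tendsto_momZR ω).matrixTranspose.matrixMul h.tendsto_momZZ_inv).matrixMul (h.tendsto_momZR ω)

lemma eventually_momZZ_det :
    ∀ᶠ x : ℕ × Ω in probFilter μ, IsUnit (ivSample y d z x.1 x.2).momZZ.det :=
  (h.tendsto_momZZ.matrixDet.eventually_ne h.nonsing).mono fun _ hx => isUnit_iff_ne_zero.2 hx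

variable (hmaj : ((invalidSet α).card : ℝ) < (p : ℝ) / 2) (hω : ω ∈ modelSpace p)
include hmaj hω

lemma eventually_gram_det :
    ∀ᶠ x : ℕ × Ω in probFilter μ, IsUnit ((ivSample y d z x.1 x.2).gram ω).det :=
  ((h.tendsto_gram ω).matrixDet.eventually_ne (h.popGram_posDef hmaj hω).det_pos.ne').mono
    fun _ hx => isUnit_iff_ne_zero.2 hx

lemma tendsto_gram_inv : Tendsto (fun x : ℕ × Ω => ((ivSample y d z x.1 x.2).gram ω)⁻¹)
    (probFilter μ) (𝓝 (popGram μ d z ω)⁻¹) :=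
  (h.tendsto_gram ω).matrixInv (h.popGram_posDef hmaj hω).det_pos.ne'

lemma tendsto_thetaHat : Tendsto (fun x : ℕ × Ω => (ivSample y d z x.1 x.2).thetaHat ω)
    (probFilter μ) (𝓝 (popTheta μ d z β α ω)) := by
  refine ((h.tendsto_gram_inv hmaj hω).matrixMulVec (((h.tendsto_momZR ω).matrixTranspose.matrixMul
    h.tendsto_momZZ_inv).matrixMulVec h.tendsto_mom_y)).congr' ?_
  filter_upwards [eventually_fst_ne_zero, h.eventually_momZZ_det, h.eventually_gram_det hmaj hω]
    with x h1 h2 h3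
  rw [IVData.thetaHat_eq _ h1 h2 h3]

lemma tendsto_sigmaHatSq : Tendsto (fun x : ℕ × Ω => (ivSample y d z x.1 x.2).sigmaHatSq ω)
    (probFilter μ) (𝓝 (popSigmaSq μ y d z β α ω)) := by
  have hθ := tendsto_pi_nhds.1 (h.tendsto_thetaHat hmaj hω)
  have hv : Tendsto (fun x : ℕ × Ω => errCoef ((ivSample y d z x.1 x.2).thetaHat ω none)
      (extendZero ω ((ivSample y d z x.1 x.2).thetaHat ω))) (probFilter μ)
      (𝓝 (errCoef (popTheta μ d z β α ω none) (extendZero ω (popTheta μ d z β α ω)))) := by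
    refine tendsto_pi_nhds.2 fun k => ?_
    rcases k with _ | _ | j
    · exact tendsto_const_nhds
    · exact (hθ none).neg
    · refine Tendsto.neg ?_
      by_cases hj : j ∈ ω
      · simpa [extendZero, hj] using hθ (some ⟨j, hj⟩)
      · simpa [extendZero, hj] using tendsto_const_nhds
  simp only [IVData.sigmaHatSq_eq]
  exact hv.dotProduct' (h.tendsto_obsMat.matrixMulVec hv)

lemma eventually_regular : ∀ᶠ x : ℕ × Ω in probFilter μ, (ivSample y d z x.1 x.2).Regular ω := by
  filter_upwards [eventually_fst_ne_zero, h.eventually_momZZ_det, h.eventually_gram_det hmaj hω,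
    (h.tendsto_sigmaHatSq hmaj hω).eventually_const_lt (h.popSigmaSq_pos hmaj hω)]
    with x h1 h2 h3 h4
  exact ⟨h1, h2, h3, h4⟩

end Limits

end IVModel

/-! ### Score expansions, marginal likelihood ratios and model selection. -/

/-- The scaled score `n^{-1/2} ∑ zᵢ εᵢ`. -/
def scoreVec {Ω : Type*} {p : ℕ} (y d : ℕ → Ω → ℝ) (z : ℕ → Ω → Fin p → ℝ) (β : ℝ)
    (α : Fin p → ℝ) (x : ℕ × Ω) : Fin p → ℝ :=
  fun j => (√x.1)⁻¹ * ∑ i : Fin x.1, z i x.2 j * structErr y d z β α i x.2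

lemma ivSample_mom_y {Ω : Type*} {p : ℕ} (y d : ℕ → Ω → ℝ) (z : ℕ → Ω → Fin p → ℝ) (β : ℝ)
    (α : Fin p → ℝ) (x : ℕ × Ω) :
    (ivSample y d z x.1 x.2).mom (ivSample y d z x.1 x.2).y =
      β • (ivSample y d z x.1 x.2).mom (ivSample y d z x.1 x.2).d +
        (ivSample y d z x.1 x.2).momZZ *ᵥ α + (√x.1)⁻¹ • scoreVec y d z β α x := by
  have hroot : (√(x.1 : ℝ))⁻¹ * (√x.1)⁻¹ = (x.1 : ℝ)⁻¹ := by
    rw [← mul_inv, Real.mul_self_sqrt (Nat.cast_nonneg _)]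
  have hy : (ivSample y d z x.1 x.2).y = β • (ivSample y d z x.1 x.2).d +
      (ivSample y d z x.1 x.2).Z *ᵥ α + fun i : Fin x.1 => structErr y d z β α i x.2 := by
    ext i
    simp only [ivSample, structErr, Pi.add_apply, Pi.smul_apply, smul_eq_mul, Matrix.mulVec]
    ring
  have hs : (√x.1)⁻¹ • scoreVec y d z β α x =
      (ivSample y d z x.1 x.2).mom fun i : Fin x.1 => structErr y d z β α i x.2 := by
    ext j
    simp only [scoreVec, Pi.smul_apply, smul_eq_mul, IVData.mom, ← mul_assoc, hroot]
    rfl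
  rw [hs]
  conv_lhs => rw [hy]
  simp only [IVData.mom, IVData.momZZ, Matrix.mulVec_add, Matrix.mulVec_smul, smul_add,
    Matrix.mulVec_mulVec, Matrix.smul_mulVec]
  rw [smul_comm]

lemma invalidSet_mem_modelSpace {p : ℕ} {α : Fin p → ℝ}
    (hmaj : ((invalidSet α).card : ℝ) < (p : ℝ) / 2) : invalidSet α ∈ modelSpace p :=
  Finset.mem_filter.2 ⟨Finset.mem_univ _, hmaj⟩

namespace IVModel

variable {Ω : Type*} {p : ℕ} {y d : ℕ → Ω → ℝ} {z : ℕ → Ω → Fin p → ℝ} {β : ℝ} {α : Fin p → ℝ} {σsq : ℝ}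
  {ω : Finset (Fin p)}

lemma thetaHat_eq_add {x : ℕ × Ω} (hreg : (ivSample y d z x.1 x.2).Regular ω)
    (hsub : invalidSet α ⊆ ω) :
    (ivSample y d z x.1 x.2).thetaHat ω = (fun k : Option ω => k.elim β fun j => α j) +
      (√x.1)⁻¹ • (((ivSample y d z x.1 x.2).gram ω)⁻¹ *ᵥ
        ((((ivSample y d z x.1 x.2).momZR ω)ᵀ * (ivSample y d z x.1 x.2).momZZ⁻¹) *ᵥ
          scoreVec y d z β α x)) := by
  rw [IVData.thetaHat_eq _ hreg.n_ne_zero hreg.momZZ_det hreg.gram_det,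
    ivSample_mom_y y d z β α x, smul_add_mulVec_eq_crossMat_mulVec _ _ _ hsub,
    ← IVData.momZR_eq, Matrix.mulVec_add, Matrix.mulVec_add, Matrix.mulVec_smul,
    Matrix.mulVec_smul, Matrix.mulVec_mulVec _ _ ((ivSample y d z x.1 x.2).momZR ω), ← IVData.gram,
    Matrix.mulVec_mulVec _ _ ((ivSample y d z x.1 x.2).gram ω),
    Matrix.nonsing_inv_mul _ hreg.gram_det, Matrix.one_mulVec]

/-- The projection residual of the score in the model `ω`, for an arbitrary vector `u`. -/
def scoreResid {n : ℕ} (D : IVData n p) (ω : Finset (Fin p)) (u : Fin p → ℝ) : Fin p → ℝ :=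
  u - D.momZR ω *ᵥ ((D.gram ω)⁻¹ *ᵥ (((D.momZR ω)ᵀ * D.momZZ⁻¹) *ᵥ u))

lemma scoreResid_smul {n : ℕ} (D : IVData n p) (ω : Finset (Fin p)) (a : ℝ) (u : Fin p → ℝ) :
    scoreResid D ω (a • u) = a • scoreResid D ω u := by
  simp only [scoreResid, Matrix.mulVec_smul, smul_sub]

/-- The misfit is a quadratic form in the score, so a factor a² can be moved inside as scaling of
the score. With a = (log n)^{-1/2} this yields T_ω / log n → 0 without a limit law for T_ω. -/
lemma sq_mul_misfit {x : ℕ × Ω} (hreg : (ivSample y d z x.1 x.2).Regular ω)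
    (hsub : invalidSet α ⊆ ω) (a : ℝ) :
    a ^ 2 * (ivSample y d z x.1 x.2).misfit ω =
      (scoreResid (ivSample y d z x.1 x.2) ω (a • scoreVec y d z β α x) ⬝ᵥ
        ((ivSample y d z x.1 x.2).momZZ⁻¹ *ᵥ
          scoreResid (ivSample y d z x.1 x.2) ω (a • scoreVec y d z β α x))) /
        (ivSample y d z x.1 x.2).sigmaHatSq ω := by
  have hn : (0 : ℝ) < x.1 := Nat.cast_pos.2 (Nat.pos_of_ne_zero hreg.n_ne_zero)
  have hm : (ivSample y d z x.1 x.2).mom ((ivSample y d z x.1 x.2).y -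
      (ivSample y d z x.1 x.2).yHat ω) =
      (√x.1)⁻¹ • scoreResid (ivSample y d z x.1 x.2) ω (scoreVec y d z β α x) := by
    rw [IVData.mom_sub, IVData.yHat, IVData.mom_R_mulVec, thetaHat_eq_add hreg hsub,
      ivSample_mom_y y d z β α x, smul_add_mulVec_eq_crossMat_mulVec _ _ _ hsub,
      ← IVData.momZR_eq, Matrix.mulVec_add, Matrix.mulVec_smul, scoreResid, smul_sub]
    abel
  have hr : (√x.1)⁻¹ * (√(x.1 : ℝ))⁻¹ = (x.1 : ℝ)⁻¹ := by
    rw [← mul_inv, Real.mul_self_sqrt hn.le]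
  rw [IVData.misfit, IVData.projNormSq_eq _ hreg.n_ne_zero hreg.momZZ_det, hm, scoreResid_smul,
    Matrix.mulVec_smul, Matrix.mulVec_smul, smul_dotProduct, smul_dotProduct, dotProduct_smul,
    dotProduct_smul]
  simp only [smul_eq_mul]
  rw [← mul_assoc (√x.1)⁻¹, hr, ← mul_assoc (x.1 : ℝ), mul_inv_cancel₀ hn.ne']
  ring

variable [MeasurableSpace Ω] {μ : Measure Ω} (h : IVModel μ y d z β α σsq) [IsProbabilityMeasure μ]
include h

lemma tendsto_smul_scoreVec {a : ℕ → ℝ} (ha : Tendsto a atTop (𝓝 0)) :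
    Tendsto (fun x : ℕ × Ω => a x.1 • scoreVec y d z β α x) (probFilter μ) (𝓝 0) := by
  refine tendsto_pi_nhds.2 fun j => ?_
  have := h.tendsto_mul_score (a := fun n _ => a n) (Pi.single j 1)
    (ha.comp tendsto_fst_probFilter)
  simpa [scoreVec] using this

variable (hmaj : ((invalidSet α).card : ℝ) < (p : ℝ) / 2)
include hmaj

lemma tendsto_misfit_div_log (hω : ω ∈ modelSpace p) (hsub : invalidSet α ⊆ ω) :
    Tendsto (fun x : ℕ × Ω => (ivSample y d z x.1 x.2).misfit ω / Real.log x.1) (probFilter μ)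
      (𝓝 0) := by
  have hlog : Tendsto (fun n : ℕ => Real.log n) atTop atTop :=
    Real.tendsto_log_atTop.comp tendsto_natCast_atTop_atTop
  have ha : Tendsto (fun n : ℕ => (√(Real.log n))⁻¹) atTop (𝓝 0) :=
    tendsto_inv_atTop_zero.comp (Real.tendsto_sqrt_atTop.comp hlog)
  have hu := h.tendsto_smul_scoreVec ha
  have he : Tendsto (fun x : ℕ × Ω => scoreResid (ivSample y d z x.1 x.2) ω
      ((√(Real.log x.1))⁻¹ • scoreVec y d z β α x)) (probFilter μ) (𝓝 0) := by
    have := hu.sub ((h.tendsto_momZR ω).matrixMulVec ((h.tendsto_gram_inv hmaj hω).matrixMulVec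
      (((h.tendsto_momZR ω).matrixTranspose.matrixMul h.tendsto_momZZ_inv).matrixMulVec hu)))
    simpa only [scoreResid, Matrix.mulVec_zero, sub_zero] using this
  have hlim := (he.dotProduct' (h.tendsto_momZZ_inv.matrixMulVec he)).div
    (h.tendsto_sigmaHatSq hmaj hω) (h.popSigmaSq_pos hmaj hω).ne'
  rw [zero_dotProduct, zero_div] at hlim
  refine hlim.congr' ?_
  filter_upwards [h.eventually_regular hmaj hω,
    tendsto_fst_probFilter.eventually (hlog.eventually_ge_atTop 0)] with x hreg hx
  rw [Pi.div_apply, ← sq_mul_misfit hreg hsub, inv_pow, Real.sq_sqrt hx, div_eq_inv_mul]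

/-- The probability limit of `misfit / n`. -/
lemma tendsto_misfit_div (hω : ω ∈ modelSpace p) :
    Tendsto (fun x : ℕ × Ω => (ivSample y d z x.1 x.2).misfit ω / x.1) (probFilter μ)
      (𝓝 ((popResid μ d z β α ω ⬝ᵥ ((popZZ μ z)⁻¹ *ᵥ popResid μ d z β α ω)) /
        popSigmaSq μ y d z β α ω)) := by
  have he : Tendsto (fun x : ℕ × Ω => (ivSample y d z x.1 x.2).mom (ivSample y d z x.1 x.2).y -
      (ivSample y d z x.1 x.2).momZR ω *ᵥ (ivSample y d z x.1 x.2).thetaHat ω) (probFilter μ)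
      (𝓝 (popResid μ d z β α ω)) :=
    h.tendsto_mom_y.sub ((h.tendsto_momZR ω).matrixMulVec (h.tendsto_thetaHat hmaj hω))
  refine ((he.dotProduct' (h.tendsto_momZZ_inv.matrixMulVec he)).div
    (h.tendsto_sigmaHatSq hmaj hω) (h.popSigmaSq_pos hmaj hω).ne').congr' ?_
  filter_upwards [h.eventually_regular hmaj hω] with x hreg
  have hn : (x.1 : ℝ) ≠ 0 := Nat.cast_ne_zero.2 hreg.n_ne_zero
  have hσ := hreg.sigma_pos.ne'
  rw [Pi.div_apply, IVData.misfit, IVData.projNormSq_eq _ hreg.n_ne_zero hreg.momZZ_det,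
    IVData.mom_sub, IVData.yHat, IVData.mom_R_mulVec]
  field_simp

lemma popMisfit_pos (hω : ω ∈ modelSpace p) (hsub : ¬ invalidSet α ⊆ ω) :
    0 < (popResid μ d z β α ω ⬝ᵥ ((popZZ μ z)⁻¹ *ᵥ popResid μ d z β α ω)) /
        popSigmaSq μ y d z β α ω := by
  refine div_pos ?_ (h.popSigmaSq_pos hmaj hω)
  have := h.popZZ_posDef.inv.dotProduct_mulVec_pos (x := popResid μ d z β α ω)
    (mt (h.popResid_eq_zero_iff hmaj hω).1 hsub)
  simpa using this

lemma tendsto_log_margLik_add_misfit (hω : ω ∈ modelSpace p) :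
    Tendsto (fun x : ℕ × Ω => (2 * Real.log ((ivSample y d z x.1 x.2).margLik ω) +
      (ivSample y d z x.1 x.2).misfit ω) / Real.log x.1) (probFilter μ)
      (𝓝 (-(1 + ω.card : ℝ))) := by
  have hlog : Tendsto (fun x : ℕ × Ω => Real.log x.1) (probFilter μ) atTop :=
    (Real.tendsto_log_atTop.comp tendsto_natCast_atTop_atTop).comp tendsto_fst_probFilter
  have hσ := h.popSigmaSq_pos hmaj hω
  have h1 := (((((h.tendsto_sigmaHatSq hmaj hω).const_mul (2 * Real.pi)).log
    (by positivity)).const_mul (1 + ω.card - p : ℝ)).sub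
      (h.tendsto_momZZ.matrixDet.log h.nonsing)).sub ((h.tendsto_gram ω).matrixDet.log
        (h.popGram_posDef hmaj hω).det_pos.ne')
  -- `h1` collects the convergent terms, which vanish after division by log n; the subtracted
  -- constant is the exact contribution of the penalty.
  have h2 := (h1.div_atTop hlog).sub_const (1 + ω.card : ℝ)
  rw [zero_sub] at h2
  refine h2.congr' ?_
  filter_upwards [h.eventually_regular hmaj hω, hlog.eventually_gt_atTop 0] with x hreg hx
  rw [hreg.two_mul_log_margLik_add_misfit]
  field_simp

lemma tendsto_log_margLik_ratio_add_misfit (hω : ω ∈ modelSpace p) :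
    Tendsto (fun x : ℕ × Ω => (2 * Real.log ((ivSample y d z x.1 x.2).margLik ω) -
      2 * Real.log ((ivSample y d z x.1 x.2).margLik (invalidSet α)) +
        (ivSample y d z x.1 x.2).misfit ω) / Real.log x.1) (probFilter μ)
      (𝓝 ((invalidSet α).card - ω.card)) := by
  have h0 := invalidSet_mem_modelSpace hmaj
  -- The expansion for `ω*` carries its own misfit, which is o_p(log n) and is added back.
  have := ((h.tendsto_log_margLik_add_misfit hmaj hω).sub
    (h.tendsto_log_margLik_add_misfit hmaj h0)).add
      (h.tendsto_misfit_div_log hmaj h0 Finset.Subset.rfl)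
  convert this using 2
  · ring
  · ring

lemma tendsto_log_margLik_ratio (hω : ω ∈ modelSpace p) (hsub : invalidSet α ⊆ ω) :
    Tendsto (fun x : ℕ × Ω => (2 * Real.log ((ivSample y d z x.1 x.2).margLik ω) -
      2 * Real.log ((ivSample y d z x.1 x.2).margLik (invalidSet α))) / Real.log x.1)
      (probFilter μ) (𝓝 ((invalidSet α).card - ω.card)) := by
  have := (h.tendsto_log_margLik_ratio_add_misfit hmaj hω).sub
    (h.tendsto_misfit_div_log hmaj hω hsub)
  convert this using 2
  · ring
  · ring

/-- Two rates: an overfitted model loses a multiple of log n through its dimension, while a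
misspecified one loses a multiple of n through its misfit, against which log n is negligible. -/
lemma tendsto_log_margLik_sub_atBot (hω : ω ∈ modelSpace p) (hne : ω ≠ invalidSet α) :
    Tendsto (fun x : ℕ × Ω => 2 * Real.log ((ivSample y d z x.1 x.2).margLik ω) -
      2 * Real.log ((ivSample y d z x.1 x.2).margLik (invalidSet α))) (probFilter μ) atBot := by
  have hn : Tendsto (fun x : ℕ × Ω => (x.1 : ℝ)) (probFilter μ) atTop :=
    tendsto_natCast_atTop_atTop.comp tendsto_fst_probFilter
  have hlog := Real.tendsto_log_atTop.comp hn
  by_cases hsub : invalidSet α ⊆ ω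
  · have hcard : ((invalidSet α).card : ℝ) - ω.card < 0 := by
      have := Finset.card_lt_card (hsub.ssubset_of_ne hne.symm)
      rw [sub_neg]
      exact_mod_cast this
    refine (hlog.atTop_mul_neg hcard (h.tendsto_log_margLik_ratio hmaj hω hsub)).congr' ?_
    filter_upwards [hlog.eventually_gt_atTop 0] with x hx
    have hx' : Real.log x.1 ≠ 0 := hx.ne'
    rw [Function.comp_apply, mul_div_cancel₀ _ hx']
  · have hratio : Tendsto (fun x : ℕ × Ω => Real.log x.1 / (x.1 : ℝ)) (probFilter μ) (𝓝 0) :=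
      (Real.isLittleO_log_id_atTop.tendsto_div_nhds_zero).comp hn
    have hlim := ((h.tendsto_log_margLik_ratio_add_misfit hmaj hω).mul hratio).sub
      (h.tendsto_misfit_div hmaj hω)
    rw [mul_zero, zero_sub] at hlim
    refine (hn.atTop_mul_neg (neg_neg_of_pos (h.popMisfit_pos hmaj hω hsub)) hlim).congr' ?_
    filter_upwards [hlog.eventually_gt_atTop 0, hn.eventually_gt_atTop 0] with x hx hx2
    have hx' : Real.log x.1 ≠ 0 := hx.ne'
    field_simp
    ring

lemma tendsto_margLik_div (hω : ω ∈ modelSpace p) (hne : ω ≠ invalidSet α) :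
    Tendsto (fun x : ℕ × Ω => (ivSample y d z x.1 x.2).margLik ω /
      (ivSample y d z x.1 x.2).margLik (invalidSet α)) (probFilter μ) (𝓝 0) := by
  have h1 := (h.tendsto_log_margLik_sub_atBot hmaj hω hne).atBot_mul_const
    (show (0 : ℝ) < 1 / 2 by norm_num)
  refine (Real.tendsto_exp_atBot.comp h1).congr' ?_
  filter_upwards [h.eventually_regular hmaj hω,
    h.eventually_regular hmaj (invalidSet_mem_modelSpace hmaj)] with x hx hx0
  rw [Function.comp_apply, ← Real.exp_log (div_pos hx.margLik_pos hx0.margLik_pos),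
    Real.log_div hx.margLik_pos.ne' hx0.margLik_pos.ne']
  congr 1
  ring

/-- Model selection consistency. -/
lemma tendsto_postModel : Tendsto (fun x : ℕ × Ω =>
    (ivSample y d z x.1 x.2).postModel (invalidSet α)) (probFilter μ) (𝓝 1) := by
  have h0 := invalidSet_mem_modelSpace hmaj
  have hsum : Tendsto (fun x : ℕ × Ω => 1 + ∑ ω ∈ (modelSpace p).erase (invalidSet α),
      (ivSample y d z x.1 x.2).margLik ω / (ivSample y d z x.1 x.2).margLik (invalidSet α))
      (probFilter μ) (𝓝 (1 + ∑ ω ∈ (modelSpace p).erase (invalidSet α), 0)) :=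
    (tendsto_finsetSum _ fun ω hω => h.tendsto_margLik_div hmaj (Finset.mem_of_mem_erase hω)
      (Finset.ne_of_mem_erase hω)).const_add 1
  rw [Finset.sum_const_zero, add_zero] at hsum
  have := hsum.inv₀ one_ne_zero
  rw [inv_one] at this
  refine this.congr' ?_
  filter_upwards [h.eventually_regular hmaj h0] with x hx
  have hpos := hx.margLik_pos.ne'
  rw [IVData.postModel, if_pos h0, ← Finset.add_sum_erase _ _ h0, ← Finset.sum_div,
    one_add_div hpos, inv_div]

end IVModel

/-! ### Averaged posteriors for a fixed data set. -/

namespace IVData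

variable {n p : ℕ} {D : IVData n p}

lemma Regular.isProbabilityMeasure_postBeta {ω : Finset (Fin p)} (h : D.Regular ω) :
    IsProbabilityMeasure (D.postBeta ω) := by
  rw [h.postBeta_eq]
  infer_instance

section PosteriorModel

variable (hreg : ∀ ω ∈ modelSpace p, D.Regular ω) {ω₀ : Finset (Fin p)} (h₀ : ω₀ ∈ modelSpace p)
include hreg h₀

lemma sum_margLik_pos : 0 < ∑ ω ∈ modelSpace p, D.margLik ω :=
  Finset.sum_pos (fun ω hω => (hreg ω hω).margLik_pos) ⟨ω₀, h₀⟩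

lemma postModel_pos : 0 < D.postModel ω₀ := by
  rw [postModel, if_pos h₀]
  exact div_pos (hreg ω₀ h₀).margLik_pos (sum_margLik_pos hreg h₀)

lemma sum_postModel : ∑ ω ∈ modelSpace p, D.postModel ω = 1 := by
  have h1 : ∀ ω ∈ modelSpace p, D.postModel ω =
      D.margLik ω / ∑ ω' ∈ modelSpace p, D.margLik ω' := fun ω hω => by
    rw [postModel, if_pos hω]
  rw [Finset.sum_congr rfl h1, ← Finset.sum_div, div_self (sum_margLik_pos hreg h₀).ne']

/-- An averaged posterior is as close to the posterior in the model `ω₀` as the posterior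
probability of that model is to one. -/
lemma abs_avgPostBeta_sub_le {A : Finset (Finset (Fin p))} (hA : A ⊆ modelSpace p) (hA₀ : ω₀ ∈ A)
    (B : Set ℝ) : |(D.avgPostBeta A).real B - (D.postBeta ω₀).real B| ≤ 1 - D.postModel ω₀ := by
  have hpos : ∀ ω ∈ A, 0 ≤ D.postModel ω := fun ω hω => (postModel_pos hreg (hA hω)).le
  have hpos₀ := postModel_pos hreg h₀
  have hle : ∑ ω ∈ A, D.postModel ω ≤ 1 := by
    rw [← sum_postModel hreg h₀]
    exact Finset.sum_le_sum_of_subset_of_nonneg hA fun ω hω _ => (postModel_pos hreg hω).le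
  have hsum : 0 < ∑ ω ∈ A, D.postModel ω :=
    hpos₀.trans_le (Finset.single_le_sum hpos hA₀)
  refine (abs_mixture_sub_le hA₀ (fun ω hω => div_nonneg (hpos ω hω) hsum.le) ?_
    (fun ω hω => (hreg ω (hA hω)).isProbabilityMeasure_postBeta) B).trans ?_
  · rw [← Finset.sum_div, div_self hsum.ne']
  · exact sub_le_sub_left (le_div_self hpos₀.le hsum hle) _

/-- A model with more than half the posterior mass is the mode, and `1 ≤ c` keeps the mode in the
set. -/
lemma mem_bestModels {c : ℝ} (hc : 1 ≤ c) (hhalf : 1 / 2 < D.postModel ω₀) :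
    ω₀ ∈ D.bestModels c := by
  classical
  refine Finset.mem_filter.2 ⟨h₀, fun ω hω => ?_⟩
  rcases eq_or_ne ω ω₀ with rfl | hne
  · exact le_mul_of_one_le_left (postModel_pos hreg h₀).le hc
  · have h1 : D.postModel ω + D.postModel ω₀ ≤ 1 := by
      rw [← sum_postModel hreg h₀, ← Finset.sum_pair hne]
      refine Finset.sum_le_sum_of_subset_of_nonneg ?_ fun ω hω _ => (postModel_pos hreg hω).le
      intro ω' hω'
      rcases Finset.mem_insert.1 hω' with rfl | hω''
      · exact hω
      · rwa [Finset.mem_singleton.1 hω'']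
    have h2 : D.postModel ω₀ ≤ c * D.postModel ω₀ :=
      le_mul_of_one_le_left (postModel_pos hreg h₀).le hc
    linarith

end PosteriorModel

/-- The posterior of `β` in a model, centred and scaled. -/
lemma Regular.map_postBeta {ω : Finset (Fin p)} (h : D.Regular ω) :
    (D.postBeta ω).map (fun b => √n * (b - D.tsls ω)) =
      gaussianReal 0 (D.sigmaHatSq ω * (D.gram ω)⁻¹ none none).toNNReal := by
  have hn : (n : ℝ) ≠ 0 := Nat.cast_ne_zero.2 h.n_ne_zero
  have hcomp : (fun b => √n * (b - D.tsls ω)) = (fun b => √n * b) ∘ fun b => b - D.tsls ω := rfl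
  rw [hcomp, ← Measure.map_map (by fun_prop) (by fun_prop), h.postBeta_eq,
    gaussianReal_map_sub_const, gaussianReal_map_const_mul, sub_self, mul_zero]
  congr 1
  have hg := (D.gram_posDef h.gram_det).inv.diag_pos (i := none)
  have hσ := h.sigma_pos
  have hn' : (0 : ℝ) ≤ n := Nat.cast_nonneg n
  ext
  rw [NNReal.coe_mul, Real.coe_toNNReal _ (by positivity), Real.coe_toNNReal _ (by positivity),
    NNReal.coe_mk, Real.sq_sqrt hn']
  field_simp

end IVData

/-! ### Measurability of the oracle estimator. -/

section Measurability

variable {Ω l m n : Type*} [MeasurableSpace Ω]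

lemma measurable_matrix_mul_apply [Fintype m] {A : Ω → Matrix l m ℝ} {B : Ω → Matrix m n ℝ}
    (hA : ∀ i j, Measurable fun w => A w i j) (hB : ∀ i j, Measurable fun w => B w i j) (i : l)
    (j : n) : Measurable fun w => (A w * B w) i j := by
  simp only [Matrix.mul_apply]
  exact Finset.measurable_fun_sum _ fun k _ => (hA i k).mul (hB k j)

lemma measurable_mulVec_apply [Fintype m] {A : Ω → Matrix l m ℝ} {v : Ω → m → ℝ}
    (hA : ∀ i j, Measurable fun w => A w i j) (hv : ∀ i, Measurable fun w => v w i) (i : l) :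
    Measurable fun w => (A w *ᵥ v w) i := by
  simp only [Matrix.mulVec, dotProduct]
  exact Finset.measurable_fun_sum _ fun k _ => (hA i k).mul (hv k)

lemma measurable_dotProduct_fun [Fintype m] {u v : Ω → m → ℝ}
    (hu : ∀ i, Measurable fun w => u w i) (hv : ∀ i, Measurable fun w => v w i) :
    Measurable fun w => u w ⬝ᵥ v w :=
  Finset.measurable_fun_sum _ fun k _ => (hu k).mul (hv k)

/-- The entries are det⁻¹ times the adjugate, also for singular matrices, because both inverses
default to 0 there. -/
lemma measurable_matrix_inv_apply [Fintype m] [DecidableEq m] {A : Ω → Matrix m m ℝ}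
    (hA : ∀ i j, Measurable fun w => A w i j) (i j : m) : Measurable fun w => (A w)⁻¹ i j := by
  have hm : Measurable fun w => (fun i j => A w i j : m → m → ℝ) :=
    measurable_pi_lambda _ fun i => measurable_pi_lambda _ fun j => hA i j
  have hof : Continuous fun M : m → m → ℝ => (Matrix.of M : Matrix m m ℝ) := continuous_id
  have hdet : Measurable fun w => (A w).det :=
    (hof.matrix_det).measurable.comp hm
  have hadj : Measurable fun w => (A w).adjugate i j :=
    (hof.matrix_adjugate.matrix_elem i j).measurable.comp hm
  simp only [Matrix.inv_def, Matrix.smul_apply, smul_eq_mul, Ring.inverse_eq_inv']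
  exact hdet.inv.mul hadj

lemma measurable_projMat_apply {n : ℕ} {κ : Type*} [Fintype κ] [DecidableEq κ]
    {A : Ω → Matrix (Fin n) κ ℝ} (hA : ∀ i j, Measurable fun w => A w i j) (i j : Fin n) :
    Measurable fun w => projMat (A w) i j := by
  have hT : ∀ i j, Measurable fun w => (A w)ᵀ i j := fun i j => hA j i
  exact measurable_matrix_mul_apply (measurable_matrix_mul_apply hA
    (measurable_matrix_inv_apply (measurable_matrix_mul_apply hT hA))) hT i j

end Measurability

/-! ### The oracle limit. -/

namespace IVModel

variable {Ω : Type*} [MeasurableSpace Ω] {μ : Measure Ω} {p : ℕ} {y d : ℕ → Ω → ℝ}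
  {z : ℕ → Ω → Fin p → ℝ} {β : ℝ} {α : Fin p → ℝ} {σsq : ℝ} {ω : Finset (Fin p)}
  (h : IVModel μ y d z β α σsq)
include h

lemma measurable_tsls (n : ℕ) (ω : Finset (Fin p)) :
    Measurable fun w => (ivSample y d z n w).tsls ω := by
  have hz : ∀ (i : Fin n) j, Measurable fun w => (ivSample y d z n w).Z i j := fun i j =>
    (measurable_pi_apply j).comp (h.measurable_z i)
  have hy : ∀ i : Fin n, Measurable fun w => (ivSample y d z n w).y i := fun i => h.measurable_y i
  have hd : ∀ i, Measurable fun w => (ivSample y d z n w).dHat i :=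
    measurable_mulVec_apply (measurable_projMat_apply hz) fun i => h.measurable_d i
  have hM : ∀ i j, Measurable fun w =>
      ((1 : Matrix (Fin n) (Fin n) ℝ) - projMat ((ivSample y d z n w).Zsub ω)) i j := fun i j =>
    measurable_const.sub (measurable_projMat_apply
      (A := fun w => (ivSample y d z n w).Zsub ω) (fun i k => hz i k) i j)
  exact (measurable_dotProduct_fun hd (measurable_mulVec_apply hM hd)).inv.mul
    (measurable_dotProduct_fun hd (measurable_mulVec_apply hM hy))

variable (hmaj : ((invalidSet α).card : ℝ) < (p : ℝ) / 2)
include hmaj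

lemma oracleVar_eq : oracleVar μ d z σsq (invalidSet α) =
    σsq * (popGram μ d z (invalidSet α))⁻¹ none none := by
  have hG : IsUnit (gramMat (popZZ μ z) (popZD μ d z) (invalidSet α)).det :=
    (Matrix.isUnit_iff_isUnit_det _).1
      (h.popGram_posDef hmaj (invalidSet_mem_modelSpace hmaj)).isUnit
  rw [popGram, eq_inv_of_mul_eq_one_right (schurCompl_mul_inv h.popZZ_posDef hG)]
  rfl

lemma oracleVar_pos : 0 < oracleVar μ d z σsq (invalidSet α) := by
  rw [h.oracleVar_eq hmaj]
  exact mul_pos h.sigma_pos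
    (h.popGram_posDef hmaj (invalidSet_mem_modelSpace hmaj)).inv.diag_pos

variable [IsProbabilityMeasure μ]

lemma tendsto_postVar : Tendsto (fun x : ℕ × Ω =>
    (ivSample y d z x.1 x.2).sigmaHatSq (invalidSet α) *
      ((ivSample y d z x.1 x.2).gram (invalidSet α))⁻¹ none none) (probFilter μ)
    (𝓝 (oracleVar μ d z σsq (invalidSet α))) := by
  have h₀ := invalidSet_mem_modelSpace hmaj
  rw [h.oracleVar_eq hmaj, ← h.popSigmaSq_of_subset hmaj h₀ Finset.Subset.rfl]
  exact (h.tendsto_sigmaHatSq hmaj h₀).mul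
    (tendsto_matrix_iff.1 (h.tendsto_gram_inv hmaj h₀) none none)

lemma eventually_forall_regular : ∀ᶠ x : ℕ × Ω in probFilter μ, ∀ ω ∈ modelSpace p,
    (ivSample y d z x.1 x.2).Regular ω :=
  (Finset.eventually_all _).2 fun _ hω => h.eventually_regular hmaj hω

/-- Averaged posteriors whose set of models eventually contains the true one have the oracle
limit in total variation. -/
lemma tendsto_tvDistance_avgPostBeta {A : ℕ × Ω → Finset (Finset (Fin p))}
    (hA : ∀ x, A x ⊆ modelSpace p) (hA₀ : ∀ᶠ x in probFilter μ, invalidSet α ∈ A x) :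
    Tendsto (fun x : ℕ × Ω => tvDistance ((ivSample y d z x.1 x.2).avgPostBeta (A x))
      ((ivSample y d z x.1 x.2).postBeta (invalidSet α))) (probFilter μ) (𝓝 0) ∧
    Tendsto (fun x : ℕ × Ω => tvDistance (((ivSample y d z x.1 x.2).avgPostBeta (A x)).map
        fun b => √x.1 * (b - (ivSample y d z x.1 x.2).tsls (invalidSet α)))
      (gaussianReal 0 (oracleVar μ d z σsq (invalidSet α)).toNNReal)) (probFilter μ) (𝓝 0) := by
  have h₀ := invalidSet_mem_modelSpace hmaj
  have hpost : Tendsto (fun x : ℕ × Ω => 1 - (ivSample y d z x.1 x.2).postModel (invalidSet α))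
      (probFilter μ) (𝓝 0) := by
    simpa using (h.tendsto_postModel hmaj).const_sub 1
  have hgauss := (tendsto_tvDistance_gaussianReal (h.oracleVar_pos hmaj)).comp
    (h.tendsto_postVar hmaj)
  have hsum := hpost.add hgauss
  rw [add_zero] at hsum
  constructor
  · refine tendsto_of_tendsto_of_tendsto_of_le_of_le' tendsto_const_nhds hpost
      (Eventually.of_forall fun _ => tvDistance_nonneg _ _) ?_
    filter_upwards [h.eventually_forall_regular hmaj, hA₀] with x hreg hx
    exact tvDistance_le fun B _ => IVData.abs_avgPostBeta_sub_le hreg h₀ (hA x) hx B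
  · refine tendsto_of_tendsto_of_tendsto_of_le_of_le' tendsto_const_nhds hsum
      (Eventually.of_forall fun _ => tvDistance_nonneg _ _) ?_
    filter_upwards [h.eventually_forall_regular hmaj, hA₀] with x hreg hx
    refine tvDistance_le fun B hB => ?_
    set f : ℝ → ℝ := fun b => √x.1 * (b - (ivSample y d z x.1 x.2).tsls (invalidSet α)) with hf
    have hfm : Measurable f := by fun_prop
    -- The mixture bound holds for all sets, so it survives centring and scaling by passing to
    -- preimages.
    have h1 := IVData.abs_avgPostBeta_sub_le hreg h₀ (hA x) hx (f ⁻¹' B)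
    rw [← map_measureReal_apply hfm hB, ← map_measureReal_apply hfm hB, hf,
      (hreg _ h₀).map_postBeta, ← hf] at h1
    refine (abs_sub_le _ _ _).trans (add_le_add h1 ?_)
    exact abs_sub_le_tvDistance _ _ hB

lemma eventually_mem_bestModels {c : ℝ} (hc : 1 ≤ c) : ∀ᶠ x : ℕ × Ω in probFilter μ,
    invalidSet α ∈ (ivSample y d z x.1 x.2).bestModels c := by
  filter_upwards [h.eventually_forall_regular hmaj,
    (h.tendsto_postModel hmaj).eventually_const_lt (show (1 / 2 : ℝ) < 1 by norm_num)]
    with x hreg hx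
  exact IVData.mem_bestModels hreg (invalidSet_mem_modelSpace hmaj) hc hx

/-- Asymptotic normality of the oracle two-stage least squares estimator. -/
lemma tendstoInDistribution_tsls :
    TendstoInDistribution
      (fun (n : ℕ) w => √n * ((ivSample y d z n w).tsls (invalidSet α) - β)) atTop
      (id : ℝ → ℝ) (fun _ => μ)
      (gaussianReal 0 (oracleVar μ d z σsq (invalidSet α)).toNNReal) := by
  have h₀ := invalidSet_mem_modelSpace hmaj
  set S := popZZ μ z with hS
  set Q := crossMat S (popZD μ d z) (invalidSet α) with hQ
  set G := popGram μ d z (invalidSet α) with hG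
  -- The influence vector: the limit of the coefficients with which the score enters √n(β̂ - β).
  set c : Fin p → ℝ := fun j => (G⁻¹ * (Qᵀ * S⁻¹)) none j with hc
  have hSu : IsUnit S.det := isUnit_iff_ne_zero.2 h.nonsing
  have hGu : IsUnit G.det := (Matrix.isUnit_iff_isUnit_det _).1 (h.popGram_posDef hmaj h₀).isUnit
  have hSs : Sᵀ = S := h.popZZ_posDef.1
  have hGs : Gᵀ = G := gramMat_transpose hSs
  have hvar : oracleVar μ d z σsq (invalidSet α) = σsq * (c ⬝ᵥ (S *ᵥ c)) := by
    have h1 : c ⬝ᵥ (S *ᵥ c) =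
        ((G⁻¹ * (Qᵀ * S⁻¹)) * (S * (G⁻¹ * (Qᵀ * S⁻¹))ᵀ)) none none := rfl
    -- Under homoscedasticity the sandwich variance collapses, since QᵀS⁻¹Q = G.
    have h2 : (G⁻¹ * (Qᵀ * S⁻¹)) * (S * (G⁻¹ * (Qᵀ * S⁻¹))ᵀ) = G⁻¹ := by
      rw [Matrix.transpose_mul, Matrix.transpose_mul, Matrix.transpose_transpose,
        Matrix.transpose_nonsing_inv, Matrix.transpose_nonsing_inv, hSs, hGs,
        ← Matrix.mul_assoc S, ← Matrix.mul_assoc S, Matrix.mul_nonsing_inv _ hSu, Matrix.one_mul,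
        Matrix.mul_assoc, ← Matrix.mul_assoc _ Q]
      change G⁻¹ * (G * G⁻¹) = G⁻¹
      rw [Matrix.mul_nonsing_inv _ hGu, Matrix.mul_one]
    rw [h1, h2, h.oracleVar_eq hmaj]
  rw [hvar]
  refine tendstoInDistribution_of_tendstoInMeasure_sub _ _ (h.tendstoInDistribution_score c) ?_
    fun n => (((h.measurable_tsls n _).sub_const β).const_mul _).aemeasurable
  have hC : Tendsto (fun x : ℕ × Ω => ((ivSample y d z x.1 x.2).gram (invalidSet α))⁻¹ *
      (((ivSample y d z x.1 x.2).momZR (invalidSet α))ᵀ * (ivSample y d z x.1 x.2).momZZ⁻¹))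
      (probFilter μ) (𝓝 (G⁻¹ * (Qᵀ * S⁻¹))) :=
    (h.tendsto_gram_inv hmaj h₀).matrixMul
      ((h.tendsto_momZR _).matrixTranspose.matrixMul h.tendsto_momZZ_inv)
  -- Replacing the random coefficients by their limits costs a coordinatewise product of an o_p(1)
  -- term with a score bounded in L².
  have hlim : Tendsto (fun x : ℕ × Ω => ∑ j,
      ((((ivSample y d z x.1 x.2).gram (invalidSet α))⁻¹ *
      (((ivSample y d z x.1 x.2).momZR (invalidSet α))ᵀ * (ivSample y d z x.1 x.2).momZZ⁻¹)) none j
        - c j) * scoreVec y d z β α x j) (probFilter μ) (𝓝 (∑ _ : Fin p, 0)) := by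
    refine tendsto_finsetSum _ fun j _ => ?_
    have h1 := (tendsto_matrix_iff.1 hC none j).sub_const (c j)
    rw [show (G⁻¹ * (Qᵀ * S⁻¹)) none j - c j = 0 from sub_self _] at h1
    have h2 := h.tendsto_mul_score (a := fun n w =>
      (((ivSample y d z n w).gram (invalidSet α))⁻¹ *
      (((ivSample y d z n w).momZR (invalidSet α))ᵀ * (ivSample y d z n w).momZZ⁻¹)) none j - c j)
      (Pi.single j 1) h1
    simpa [scoreVec] using h2
  rw [Finset.sum_const_zero] at hlim
  refine tendstoInMeasure_const_iff.2 (hlim.congr' ?_)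
  filter_upwards [h.eventually_regular hmaj h₀] with x hreg
  have hn : (0 : ℝ) < x.1 := Nat.cast_pos.2 (Nat.pos_of_ne_zero hreg.n_ne_zero)
  have hroot : √(x.1 : ℝ) ≠ 0 := (Real.sqrt_pos.2 hn).ne'
  have h1 : √(x.1 : ℝ) * ((ivSample y d z x.1 x.2).tsls (invalidSet α) - β) =
      ∑ j, (((ivSample y d z x.1 x.2).gram (invalidSet α))⁻¹ *
      (((ivSample y d z x.1 x.2).momZR (invalidSet α))ᵀ *
        (ivSample y d z x.1 x.2).momZZ⁻¹)) none j * scoreVec y d z β α x j := by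
    rw [IVData.tsls_eq_thetaHat_none _ hreg.n_ne_zero hreg.momZZ_det hreg.gram_det,
      thetaHat_eq_add hreg Finset.Subset.rfl, Matrix.mulVec_mulVec, Pi.add_apply,
      Option.elim_none, add_sub_cancel_left, Pi.smul_apply, smul_eq_mul,
      mul_inv_cancel_left₀ hroot]
    rfl
  have h2 : (√(x.1 : ℝ))⁻¹ * ∑ i : Fin x.1, (c ⬝ᵥ z i x.2) * structErr y d z β α i x.2 =
      ∑ j, c j * scoreVec y d z β α x j := by
    simp only [scoreVec, dotProduct, Finset.mul_sum, Finset.sum_mul]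
    rw [Finset.sum_comm]
    exact Finset.sum_congr rfl fun j _ => Finset.sum_congr rfl fun i _ => by ring
  simp only [Pi.sub_apply]
  rw [h1, h2, ← Finset.sum_sub_distrib]
  exact Finset.sum_congr rfl fun j _ => by ring

end IVModel

end

/-! ### The theorem. -/

theorem theorem2 {Ω : Type*} [MeasurableSpace Ω] (μ : Measure Ω) [IsProbabilityMeasure μ]
    {p : ℕ} (y d : ℕ → Ω → ℝ) (z : ℕ → Ω → Fin p → ℝ) (β : ℝ) (α : Fin p → ℝ) (σsq : ℝ)
    (hmodel : IVModel μ y d z β α σsq)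
    (hmajority : ((invalidSet α).card : ℝ) < (p : ℝ) / 2) :
    -- model selection consistency
    TendstoInMeasure μ (fun n w => (ivSample y d z n w).postModel (invalidSet α)) atTop
      (fun _ => 1) ∧
    -- over-fitted models
    (∀ ω ∈ modelSpace p, invalidSet α ⊂ ω →
      TendstoInMeasure μ (fun n w =>
        (2 * Real.log ((ivSample y d z n w).margLik ω) -
          2 * Real.log ((ivSample y d z n w).margLik (invalidSet α))) / Real.log n) atTop
        (fun _ => ((invalidSet α).card : ℝ) - (ω.card : ℝ))) ∧
    -- mis-specified models
    (∀ ω ∈ modelSpace p, ¬ invalidSet α ⊆ ω →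
      TendstoInMeasure μ (fun n w =>
        (2 * Real.log ((ivSample y d z n w).margLik ω) -
          2 * Real.log ((ivSample y d z n w).margLik (invalidSet α)) +
            (ivSample y d z n w).misfit ω) / Real.log n) atTop
        (fun _ => ((invalidSet α).card : ℝ) - (ω.card : ℝ)) ∧
      ∃ κ : ℝ, 0 < κ ∧
        TendstoInMeasure μ (fun n w => (ivSample y d z n w).misfit ω / n) atTop
          (fun _ => κ)) ∧
    -- the oracle estimator is asymptotically normal
    0 < oracleVar μ d z σsq (invalidSet α) ∧
    TendstoInDistribution
      (fun (n : ℕ) w => Real.sqrt n * ((ivSample y d z n w).tsls (invalidSet α) - β)) atTop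
      (id : ℝ → ℝ) (fun _ => μ)
      (gaussianReal 0 (oracleVar μ d z σsq (invalidSet α)).toNNReal) ∧
    -- the averaged posterior over the models within a factor `c` of the best one
    (∀ c : ℝ, 1 ≤ c →
      TendstoInMeasure μ (fun n w =>
        tvDistance ((ivSample y d z n w).avgPostBeta ((ivSample y d z n w).bestModels c))
          ((ivSample y d z n w).postBeta (invalidSet α))) atTop (fun _ => 0) ∧
      TendstoInMeasure μ (fun n w =>
        tvDistance
          (((ivSample y d z n w).avgPostBeta ((ivSample y d z n w).bestModels c)).map
            fun b => Real.sqrt n * (b - (ivSample y d z n w).tsls (invalidSet α)))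
          (gaussianReal 0 (oracleVar μ d z σsq (invalidSet α)).toNNReal)) atTop
        (fun _ => 0)) ∧
    -- the averaged posterior over all candidate models
    TendstoInMeasure μ (fun n w =>
      tvDistance ((ivSample y d z n w).avgPostBeta (modelSpace p))
        ((ivSample y d z n w).postBeta (invalidSet α))) atTop (fun _ => 0) ∧
    TendstoInMeasure μ (fun n w =>
      tvDistance
        (((ivSample y d z n w).avgPostBeta (modelSpace p)).map
          fun b => Real.sqrt n * (b - (ivSample y d z n w).tsls (invalidSet α)))
        (gaussianReal 0 (oracleVar μ d z σsq (invalidSet α)).toNNReal)) atTop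
      (fun _ => 0) := by
  have h₀ := invalidSet_mem_modelSpace hmajority
  have hbest : ∀ c : ℝ, 1 ≤ c → _ := fun c hc =>
    hmodel.tendsto_tvDistance_avgPostBeta hmajority
      (A := fun x => (ivSample y d z x.1 x.2).bestModels c) (fun _ => Finset.filter_subset _ _)
      (hmodel.eventually_mem_bestModels hmajority hc)
  have hall := hmodel.tendsto_tvDistance_avgPostBeta hmajority (A := fun _ => modelSpace p)
    (fun _ => Finset.Subset.rfl) (Eventually.of_forall fun _ => h₀)
  refine ⟨tendstoInMeasure_const_iff.2 (hmodel.tendsto_postModel hmajority),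
    fun ω hω hsub => tendstoInMeasure_const_iff.2
      (hmodel.tendsto_log_margLik_ratio hmajority hω hsub.subset),
    fun ω hω hsub => ⟨tendstoInMeasure_const_iff.2
      (hmodel.tendsto_log_margLik_ratio_add_misfit hmajority hω), _,
      hmodel.popMisfit_pos hmajority hω hsub,
      tendstoInMeasure_const_iff.2 (hmodel.tendsto_misfit_div hmajority hω)⟩,
    hmodel.oracleVar_pos hmajority, hmodel.tendstoInDistribution_tsls hmajority,
    fun c hc => ⟨tendstoInMeasure_const_iff.2 (hbest c hc).1,
      tendstoInMeasure_const_iff.2 (hbest c hc).2⟩,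
    tendstoInMeasure_const_iff.2 hall.1, tendstoInMeasure_const_iff.2 hall.2⟩
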